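/- Let $n\ge 1$, let $\omega_{n-1}=2\pi^{n/2}/\Gamma(n/2)$ be the area of the unit sphere of $\mathbb R^n$, and let $K_n(t)=\sum_{k\ge 0}\frac{(-1)^k}{(n/2,k)\,k!}\left(\frac t2\right)^{2k}$, where $(\alpha,k)=\Gamma(\alpha+k)/\Gamma(\alpha)$. For a complex Borel measure $\mu$ on $\mathbb R^n$ let $|\mu|$ be its total variation, $\bar\mu(A)=\overline{\mu(A)}$, $\widehat\mu(\xi)=\int e^{i\xi\cdot x}\,d\mu(x)$ and $p_\mu(x)=\int\ln\frac1{|x-y|}\,d\mu(y)$, with $\ln\frac10=+\infty$. Let $\mathcal M_0$ be the set of complex Borel measures $\mu$ with $\iint\bigl|\ln|x-y|\bigr|\,d|\mu|(y)\,d|\mu|(x)<\infty$, let $\mathcal M_+$ be the set of finite nonnegative Borel measures, and let $\mathcal M_{0,+}$ be the set of $\mu\in\mathcal M_+$ for which $\iint \ln|x-y|\,d\mu(y)\,d\mu(x)$ exists in $[-\infty,\infty]$. For $\mu,\nu\in\mathcal M_+$ we say that $\int p_\mu\,d\nu=\iint\ln\frac1{|x-y|}\,d\mu(y)\,d\nu(x)$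 exists in $[-\infty,\infty]$ if the positive or the negative part of $\ln\frac1{|x-y|}$ has a finite integral with respect to the product measure $\mu\otimes\nu$; the existence in the definition of $\mathcal M_{0,+}$ is meant in the same sense. For $\mu\in\mathcal M_0\cup\mathcal M_{0,+}$ put $I(\mu)=\int p_\mu\,d\bar\mu$. Let $\mu,\nu\in\mathcal M_0$, or let $\mu,\nu\in\mathcal M_+$ be such that $\int p_\mu\,d\nu$ exists in $[-\infty,\infty]$. Then $p_\mu(x)$ is well defined for $|\nu|$-almost all $x$, the integral $\int p_\mu\,d\bar\nu$ is well defined (in $\mathbb C$ in the first case, in $[-\infty,\infty]$ in the second, where the integrals on the right-hand side below are real), and $$\omega_{n-1}\int p_\mu\,d\bar\nu=\lim_{\substack{\varepsilon\to0+\\N\to\infty}}\ \int_{\varepsilon\le|\xi|\le N}\Bigl(\widehat\mu(\xi)\overline{\widehat\nu(\xi)}-\mu(\mathbb R^n)\,\bar\nu(\mathbb R^n)\,K_n(|\xi|)\Bigr)\frac{d\xi}{|\xi|^n},$$ where the limit is the double limit in $(\varepsilon,N)$, taken in $\mathbb C$ in the first case and in $[-\infty,\infty]$ in the second. In particular, for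 every $\mu\in\mathcal M_0\cup\mathcal M_{0,+}$, $$\omega_{n-1}I(\mu)=\lim_{\substack{\varepsilon\to0+\\N\to\infty}}\ \int_{\varepsilon\le|\xi|\le N}\Bigl(|\widehat\mu(\xi)|^2-|\mu(\mathbb R^n)|^2K_n(|\xi|)\Bigr)\frac{d\xi}{|\xi|^n},$$ including the cases $I(\mu)=\pm\infty$ for $\mu\in\mathcal M_{0,+}$; and if $I(\mu)$ is finite (which always holds for $\mu\in\mathcal M_0$), then $\int_{|\xi|\ge R}|\widehat\mu(\xi)|^2\,\frac{d\xi}{|\xi|^n}<\infty$ for every $R>0$. -/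

import Mathlib

open MeasureTheory Filter Topology Set
open scoped ENNReal ComplexConjugate

noncomputable section

namespace LogEnergy

/-- `ℝⁿ` with the Euclidean norm. -/
abbrev Rn (n : ℕ) : Type := EuclideanSpace ℝ (Fin n)

/-- `ω_{n-1}`: the area of the unit sphere of `ℝⁿ` with respect to the surface measure. -/
def sphereArea (n : ℕ) : ℝ :=
  (volume : Measure (Rn n)).toSphere.real univ

/-- The Pochhammer symbol `(α, k) = Γ(α + k) / Γ(α)`. -/
def poch (α : ℝ) (k : ℕ) : ℝ := Real.Gamma (α + k) / Real.Gamma α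

/-- The function `K_n(t) = ∑ₖ (-1)ᵏ / ((n/2, k) k!) (t/2)^{2k}` for real `t`. -/
def K (n : ℕ) (t : ℝ) : ℝ :=
  ∑' k : ℕ, (-1 : ℝ) ^ k / (poch ((n : ℝ) / 2) k * (k.factorial : ℝ)) * (t / 2) ^ (2 * k)

/-- The closed annulus `ε ≤ |ξ| ≤ N`. -/
def annulus (n : ℕ) (ε N : ℝ) : Set (Rn n) := {ξ | ε ≤ ‖ξ‖ ∧ ‖ξ‖ ≤ N}

/-- The double-sided limit `ε → 0+`, `N → ∞` of pairs `(ε, N)`. -/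
def twoSided : Filter (ℝ × ℝ) := 𝓝[>] (0 : ℝ) ×ˢ atTop

/-- The kernel `ln (1 / |x - y|) ∈ (-∞, ∞]`, which is `+∞` for `x = y`. -/
def kernel {n : ℕ} (x y : Rn n) : EReal := ENNReal.log (edist x y)⁻¹

/-! ### Complex measures -/

section Complex

/-- The integral `∫ f dμ` of a complex function against a complex measure. -/
def cintegral {X : Type*} [MeasurableSpace X] (μ : ComplexMeasure X) (f : X → ℂ) : ℂ :=
  VectorMeasure.integral μ f (ContinuousLinearMap.mul ℝ ℂ)

/-- The conjugate measure `μ̄(A) = conj (μ(A))`. -/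
def conjMeasure {X : Type*} [MeasurableSpace X] (μ : ComplexMeasure X) : ComplexMeasure X :=
  μ.mapRange (starRingEnd ℂ).toAddMonoidHom Complex.continuous_conj

variable {n : ℕ}

/-- The Fourier transform `μ̂(ξ) = ∫ exp(i ξ·x) dμ(x)` of a complex measure. -/
def fourier (μ : ComplexMeasure (Rn n)) (ξ : Rn n) : ℂ :=
  cintegral μ fun x => Complex.exp (Complex.I * (inner ℝ ξ x : ℝ))

/-- The class `M₀`: `∫∫ |ln |x - y|| d|μ|(y) d|μ|(x) < ∞`, with `|ln 0| = ∞`. -/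
def MemM0 (μ : ComplexMeasure (Rn n)) : Prop :=
  ∫⁻ x, ∫⁻ y, (kernel x y).abs ∂μ.variation ∂μ.variation < ∞

/-- The logarithmic potential `p_μ(x) = ∫ ln (1 / |x - y|) dμ(y)` of `μ ∈ M₀`. (Such a `μ` has
no atoms, so the value given to the kernel at the single point `y = x` does not matter.) -/
def cpotential (μ : ComplexMeasure (Rn n)) (x : Rn n) : ℂ :=
  cintegral μ fun y => (Real.log (1 / ‖x - y‖) : ℂ)

/-- `∫ p_μ dν` makes sense: the integral defining `p_μ(x)` converges absolutely for `|ν|`-almost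
all `x`, and `p_μ` is integrable with respect to `|ν|`. -/
def PotentialIntegrable (μ ν : ComplexMeasure (Rn n)) : Prop :=
  (∀ᵐ x ∂ν.variation, Integrable (fun y => (Real.log (1 / ‖x - y‖) : ℂ)) μ.variation) ∧
    Integrable (cpotential μ) ν.variation

/-- The logarithmic energy `I(μ) = ∫ p_μ dμ̄` of a complex measure `μ ∈ M₀`. -/
def cenergy (μ : ComplexMeasure (Rn n)) : ℂ :=
  cintegral (conjMeasure μ) (cpotential μ)

end Complex

/-! ### Nonnegative measures -/

section Nonneg

/-- The integral `∫ f dμ` exists in `[-∞, ∞]`: `f` is measurable and at least one of the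
integrals of its positive and its negative part is finite. -/
def QuasiIntegrable {X : Type*} [MeasurableSpace X] (μ : Measure X) (f : X → EReal) : Prop :=
  AEMeasurable f μ ∧ (∫⁻ x, (f x).toENNReal ∂μ ≠ ∞ ∨ ∫⁻ x, (-f x).toENNReal ∂μ ≠ ∞)

/-- The integral `∫ f dμ ∈ [-∞, ∞]` of a quasi-integrable function: the integral of the positive
part minus the integral of the negative part. -/
def eintegral {X : Type*} [MeasurableSpace X] (μ : Measure X) (f : X → EReal) : EReal :=
  ((∫⁻ x, (f x).toENNReal ∂μ : ℝ≥0∞) : EReal) - ((∫⁻ x, (-f x).toENNReal ∂μ : ℝ≥0∞) : EReal)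

variable {n : ℕ}

/-- The logarithmic potential `p_μ(x) = ∫ ln (1 / |x - y|) dμ(y) ∈ [-∞, ∞]` of `μ ≥ 0`. -/
def potential (μ : Measure (Rn n)) (x : Rn n) : EReal := eintegral μ (kernel x)

/-- `∫ p_μ dν = ∫∫ ln (1 / |x - y|) dμ(y) dν(x)` exists in `[-∞, ∞]`, as an integral with respect
to the product measure. -/
def MutualEnergyExists (μ ν : Measure (Rn n)) : Prop :=
  QuasiIntegrable (ν.prod μ) fun z => kernel z.1 z.2

/-- The logarithmic energy `I(μ) = ∫ p_μ dμ ∈ [-∞, ∞]` of `μ ≥ 0`. -/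
def energy (μ : Measure (Rn n)) : EReal := eintegral μ (potential μ)

end Nonneg

end LogEnergy

end

/-!
By Fubini, the truncated integral on the right is the integral of a kernel against `dμ(x) dν̄(y)`, as is
`∫ p_μ dν̄` on the left. Since `K_n(|x|)` is the average of `exp(i θ·x)` over the unit sphere, the kernel
on the right is `ω_{n-1} T(|x - y|)` with `T(a) = ∫_ε^N (K_n(ra) - K_n(r)) dr/r`, a Frullani integral,
which tends to `ln (1/a)`.

The identification of `K_n` (`integral_sphere_exp`) compares power series: the moments of the sphere
are found by writing the Gaussian moments of `ℝⁿ` in polar coordinates.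

The estimates for `T` come from the differential equation of `K_n`. It makes `K_n² + (K_n')²`
decreasing (`K_energy_le`), so that `|K_n| ≤ 1` and `|K_{n+2}(t)| ≤ n/t`; as `K_n' = -(t/n) K_{n+2}`
and `(t^n K_{n+2})' = n t^{n-1} K_n`, integration by parts shows that `∫_u^v K_n(s) ds/s` is at most
`(n+2)/min(u,v)`, while near the origin it is close to `ln (v/u)`. Hence, for `ε ≤ 1 ≤ N`,
`-C - ln⁺ a ≤ T(a) ≤ C + ln⁺ (1/a)` (`le_truncKernel_one`, `truncKernel_one_le`).

With these two bounds the limit passes under the integral: by dominated convergence if the logarithmic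
kernel is absolutely integrable (`LogIntegrable.tendsto_truncKernel`), and by Fatou's lemma if just one
of its two parts is integrable (`tendsto_integral_truncKernel`). Complex measures reduce to their total
variation through a density of modulus one (`exists_polar`).

For `μ, ν ∈ M₀` the mutual energy has to be shown finite. Without the subtracted term `K_n`, the
truncated kernel is positive definite, since it is the Fourier transform of a nonnegative function.
Therefore the truncated mutual energy of `|μ|` and `|ν|` is at most the mean of the two truncated self
energies, which stay bounded; Fatou's lemma concludes (`LogIntegrable.prod`). The same boundedness gives
the integrability of `|μ̂|² / |ξ|^n` at infinity (`integrableOn_tail`).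
-/

namespace LogEnergy

/-! ### The Bessel-type function `K n` -/

lemma poch_zero {α : ℝ} (hα : 0 < α) : poch α 0 = 1 := by
  simp [poch, div_self (Real.Gamma_pos_of_pos hα).ne']

lemma poch_succ {α : ℝ} (hα : 0 < α) (k : ℕ) : poch α (k + 1) = (α + k) * poch α k := by
  have h : α + ((k + 1 : ℕ) : ℝ) = (α + k) + 1 := by push_cast; ring
  rw [poch, h, Real.Gamma_add_one (by positivity), poch, mul_div_assoc]

lemma poch_succ' {α : ℝ} (hα : 0 < α) (k : ℕ) : poch α (k + 1) = α * poch (α + 1) k := by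
  have h : α + ((k + 1 : ℕ) : ℝ) = (α + 1) + k := by push_cast; ring
  have := (Real.Gamma_pos_of_pos hα).ne'
  rw [poch, h, poch, Real.Gamma_add_one hα.ne']
  field_simp

lemma poch_pos {α : ℝ} (hα : 0 < α) (k : ℕ) : 0 < poch α k :=
  div_pos (Real.Gamma_pos_of_pos (by positivity)) (Real.Gamma_pos_of_pos hα)

/-- A lower bound uniform in `k`, so that the series of `K n` is dominated by an exponential series. -/
lemma half_le_poch {α : ℝ} (hα : 1 / 2 ≤ α) (k : ℕ) : 1 / 2 ≤ poch α k := by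
  have hα' : 0 < α := by linarith
  induction k with
  | zero => rw [poch_zero hα']; norm_num
  | succ k ih =>
    rw [poch_succ hα']
    rcases k with - | k
    · simpa [poch_zero hα'] using hα
    · push_cast
      have : (0 : ℝ) ≤ k := k.cast_nonneg
      nlinarith

/-- The `k`-th term of the power series of `K n`. -/
noncomputable def kTerm (n k : ℕ) (t : ℝ) : ℝ :=
  (-1 : ℝ) ^ k / (poch ((n : ℝ) / 2) k * (k.factorial : ℝ)) * (t / 2) ^ (2 * k)

lemma half_le_half_cast {n : ℕ} (hn : 1 ≤ n) : 1 / 2 ≤ (n : ℝ) / 2 := by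
  have : (1 : ℝ) ≤ n := by exact_mod_cast hn
  linarith

lemma abs_kTerm_le {n : ℕ} (hn : 1 ≤ n) (k : ℕ) (t : ℝ) :
    |kTerm n k t| ≤ 2 * (((t / 2) ^ 2) ^ k / k.factorial) := by
  have h1 := half_le_poch (half_le_half_cast hn) k
  have hk : (0 : ℝ) < k.factorial := by positivity
  have : |kTerm n k t| = (poch ((n : ℝ) / 2) k)⁻¹ * (((t / 2) ^ 2) ^ k / k.factorial) := by
    rw [kTerm, abs_mul, abs_div, abs_pow, abs_neg, abs_one, one_pow, pow_mul,
      abs_of_pos (by positivity : 0 < poch ((n : ℝ) / 2) k * (k.factorial : ℝ)),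
      abs_of_nonneg (by positivity : 0 ≤ ((t / 2) ^ 2) ^ k)]
    field_simp
  rw [this]
  gcongr
  rw [inv_le_comm₀ (by linarith) (by norm_num)]
  linarith

lemma summable_kTerm {n : ℕ} (hn : 1 ≤ n) (t : ℝ) : Summable fun k => kTerm n k t :=
  Summable.of_norm_bounded ((Real.summable_pow_div_factorial _).mul_left 2)
    fun k => abs_kTerm_le hn k t

lemma hasSum_kTerm {n : ℕ} (hn : 1 ≤ n) (t : ℝ) : HasSum (fun k => kTerm n k t) (K n t) :=
  (summable_kTerm hn t).hasSum

lemma kTerm_zero {n : ℕ} (hn : 1 ≤ n) (t : ℝ) : kTerm n 0 t = 1 := by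
  have := half_le_half_cast hn
  simp [kTerm, poch_zero (by linarith : 0 < (n : ℝ) / 2)]

lemma K_zero {n : ℕ} (hn : 1 ≤ n) : K n 0 = 1 := by
  refine (hasSum_kTerm hn 0).unique ?_
  rw [← kTerm_zero hn 0]
  refine hasSum_single 0 fun k hk => ?_
  simp [kTerm, hk]

lemma hasDerivAt_kTerm_succ {n : ℕ} (hn : 1 ≤ n) (k : ℕ) (t : ℝ) :
    HasDerivAt (kTerm n (k + 1)) (-(t / n) * kTerm (n + 2) k t) t := by
  have hn' : (0 : ℝ) < n := by exact_mod_cast hn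
  have h := (((hasDerivAt_id t).div_const 2).pow (2 * (k + 1))).const_mul
    ((-1 : ℝ) ^ (k + 1) / (poch ((n : ℝ) / 2) (k + 1) * ((k + 1).factorial : ℝ)))
  refine h.congr_deriv ?_
  have hp := (poch_pos (by positivity : 0 < (n : ℝ) / 2 + 1) k).ne'
  have e : ((n + 2 : ℕ) : ℝ) / 2 = n / 2 + 1 := by push_cast; ring
  have e2 : 2 * (k + 1) - 1 = 2 * k + 1 := by omega
  rw [kTerm, e, poch_succ' (by positivity), Nat.factorial_succ, e2]
  simp only [id]
  push_cast
  field_simp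
  ring

lemma hasDerivAt_K {n : ℕ} (hn : 1 ≤ n) (t : ℝ) :
    HasDerivAt (K n) (-(t / n) * K (n + 2) t) t := by
  have hn' : (1 : ℝ) ≤ n := by exact_mod_cast hn
  set R : ℝ := |t| + 1
  have hu : Summable fun k : ℕ => R * (2 * (((R / 2) ^ 2) ^ k / (k.factorial : ℝ))) :=
    ((Real.summable_pow_div_factorial _).mul_left 2).mul_left R
  have key := hasDerivAt_tsum_of_isPreconnected (t := Metric.ball (0 : ℝ) R) (y := t) (y₀ := 0)
    (g := fun k y => kTerm n (k + 1) y) (g' := fun k y => -(y / n) * kTerm (n + 2) k y)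
    hu Metric.isOpen_ball (convex_ball _ _).isPreconnected
    (fun k y _ => hasDerivAt_kTerm_succ hn k y) (fun k y hy => by
      have hy' : |y| ≤ R := by simpa using (mem_ball_zero_iff.1 hy).le
      rw [norm_mul, norm_neg, norm_div, Real.norm_natCast]
      refine mul_le_mul ((div_le_self (norm_nonneg _) hn').trans hy')
        ((abs_kTerm_le (by omega) k y).trans ?_) (norm_nonneg _) (by positivity)
      have : (y / 2) ^ 2 ≤ (R / 2) ^ 2 := by
        rw [sq_le_sq, abs_div, abs_div, abs_of_nonneg (by positivity : 0 ≤ R)]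
        gcongr
      gcongr)
    (Metric.mem_ball_self (by positivity))
    ((summable_nat_add_iff 1).2 (summable_kTerm hn 0))
    (by simp [R])
  rw [tsum_mul_left] at key
  refine ((key.const_add 1).congr_of_eventuallyEq (Eventually.of_forall fun y => ?_))
  have := (summable_kTerm hn y).tsum_eq_zero_add
  rw [kTerm_zero hn] at this
  exact this

lemma continuous_K {n : ℕ} (hn : 1 ≤ n) : Continuous (K n) :=
  continuous_iff_continuousAt.2 fun t => (hasDerivAt_K hn t).continuousAt

/-- The contiguity relation between `K n`, `K (n + 2)` and `K (n + 4)`. -/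
lemma K_contiguous {n : ℕ} (hn : 1 ≤ n) (t : ℝ) :
    n * (K n t - K (n + 2) t) = -(t ^ 2 / (n + 2)) * K (n + 4) t := by
  have hn' : (0 : ℝ) < n := by exact_mod_cast hn
  have h1 := ((hasSum_kTerm hn t).sub (hasSum_kTerm (by omega : 1 ≤ n + 2) t)).mul_left (n : ℝ)
  have h2 := (hasSum_kTerm (by omega : 1 ≤ n + 4) t).mul_left (-(t ^ 2 / (n + 2)))
  have h3 : HasSum (fun k => (n : ℝ) * (kTerm n (k + 1) t - kTerm (n + 2) (k + 1) t))
      (-(t ^ 2 / (n + 2)) * K (n + 4) t) := by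
    refine h2.congr_fun ?_
    intro k
    have hp := (poch_pos (by positivity : 0 < (n : ℝ) / 2 + 1 + 1) k).ne'
    have e : ((n + 2 : ℕ) : ℝ) / 2 = n / 2 + 1 := by push_cast; ring
    have e2 : ((n + 4 : ℕ) : ℝ) / 2 = n / 2 + 1 + 1 := by push_cast; ring
    have e3 : poch ((n : ℝ) / 2 + 1) (k + 1) * (n / 2) =
      (n / 2 + k + 1) * (n / 2 * poch ((n : ℝ) / 2 + 1) k) := by
        rw [poch_succ (by positivity)]; ring
    have e4 : poch ((n : ℝ) / 2) (k + 1) = n / 2 * poch ((n : ℝ) / 2 + 1) k :=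
      poch_succ' (by positivity) k
    have e5 : poch ((n : ℝ) / 2 + 1) (k + 1) = (n / 2 + 1) * poch ((n : ℝ) / 2 + 1 + 1) k :=
      poch_succ' (by positivity) k
    have e6 : poch ((n : ℝ) / 2 + 1) k =
        (n / 2 + 1) * poch ((n : ℝ) / 2 + 1 + 1) k / (n / 2 + 1 + k) := by
      rw [← e5, poch_succ (by positivity), mul_div_cancel_left₀ _ (by positivity)]
    rw [kTerm, kTerm, kTerm, e, e2, e4, e5, e6, Nat.factorial_succ]
    push_cast
    field_simp
    ring
  have h4 := (hasSum_nat_add_iff' (f := fun k => (n : ℝ) * (kTerm n k t - kTerm (n + 2) k t)) 1).2 h1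
  simp only [Finset.range_one, Finset.sum_singleton, kTerm_zero hn,
    kTerm_zero (by omega : 1 ≤ n + 2), sub_self, mul_zero, sub_zero] at h4
  exact h4.unique h3

lemma hasDerivAt_K_add_two {n : ℕ} (hn : 1 ≤ n) {t : ℝ} (ht : t ≠ 0) :
    HasDerivAt (K (n + 2)) (n * (K n t - K (n + 2) t) / t) t := by
  refine (hasDerivAt_K (by omega : 1 ≤ n + 2) t).congr_deriv ?_
  rw [K_contiguous hn]
  push_cast
  field_simp

/-- The energy `K² + (K')²` of the Bessel-type equation `K'' + (n - 1) / t * K' + K = 0` does not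
increase, and equals `1` at the origin. -/
lemma K_energy_le {n : ℕ} (hn : 1 ≤ n) {t : ℝ} (ht : 0 ≤ t) :
    K n t ^ 2 + (t / n * K (n + 2) t) ^ 2 ≤ 1 := by
  have hn' : (1 : ℝ) ≤ n := by exact_mod_cast hn
  have hc : Continuous fun s : ℝ => K n s ^ 2 + (s / n * K (n + 2) s) ^ 2 := by
    have := continuous_K hn
    have := continuous_K (by omega : 1 ≤ n + 2)
    fun_prop
  have hd : ∀ s ∈ interior (Ici (0 : ℝ)), HasDerivWithinAt
      (fun s : ℝ => K n s ^ 2 + (s / n * K (n + 2) s) ^ 2)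
      (-(2 * (n - 1) / n ^ 2 * s * K (n + 2) s ^ 2)) (interior (Ici (0 : ℝ))) s := by
    intro s hs
    rw [interior_Ici, mem_Ioi] at hs
    have h := ((hasDerivAt_K hn s).pow 2).add
      ((((hasDerivAt_id s).div_const (n : ℝ)).mul (hasDerivAt_K_add_two hn hs.ne')).pow 2)
    refine (h.congr_deriv ?_).hasDerivWithinAt
    have h0 : (n : ℝ) ≠ 0 := by positivity
    have h1 : s / n * (n * (K n s - K (n + 2) s) / s) = K n s - K (n + 2) s := by
      field_simp
    simp only [id, Pi.mul_apply, h1, Nat.add_one_sub_one, pow_one]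
    push_cast
    field_simp
    ring
  have anti := antitoneOn_of_hasDerivWithinAt_nonpos (convex_Ici (0 : ℝ)) hc.continuousOn hd
    (fun s hs => by
      rw [interior_Ici, mem_Ioi] at hs
      have : 0 ≤ 2 * ((n : ℝ) - 1) / n ^ 2 * s * K (n + 2) s ^ 2 := by
        have : 0 ≤ (n : ℝ) - 1 := by linarith
        positivity
      linarith)
  have := anti (mem_Ici.2 le_rfl) (mem_Ici.2 ht) ht
  simpa [K_zero hn] using this

lemma abs_K_le_one {n : ℕ} (hn : 1 ≤ n) {t : ℝ} (ht : 0 ≤ t) : |K n t| ≤ 1 := by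
  have := K_energy_le hn ht
  rw [← sq_le_one_iff_abs_le_one]
  nlinarith [sq_nonneg (t / n * K (n + 2) t)]

lemma abs_K_add_two_le {n : ℕ} (hn : 1 ≤ n) {t : ℝ} (ht : 0 < t) : |K (n + 2) t| ≤ n / t := by
  have hn' : (0 : ℝ) < n := by exact_mod_cast hn
  have h : |t / n * K (n + 2) t| ≤ 1 := by
    have := K_energy_le hn ht.le
    rw [← sq_le_one_iff_abs_le_one]
    nlinarith [sq_nonneg (K n t)]
  rw [abs_mul, abs_of_pos (by positivity)] at h
  rw [le_div_iff₀ ht]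
  rw [div_mul_eq_mul_div, div_le_one hn'] at h
  linarith

lemma abs_K_sub_one_le {n : ℕ} (hn : 1 ≤ n) {t : ℝ} (ht : 0 ≤ t) : |K n t - 1| ≤ t := by
  have h := (convex_Ici (0 : ℝ)).norm_image_sub_le_of_norm_hasDerivWithin_le (C := 1)
    (f := K n) (f' := fun s => -(s / n) * K (n + 2) s) (x := 0) (y := t)
    (fun s _ => (hasDerivAt_K hn s).hasDerivWithinAt) (fun s hs => by
      have := K_energy_le hn (mem_Ici.1 hs)
      rw [Real.norm_eq_abs, ← sq_le_one_iff_abs_le_one]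
      nlinarith [sq_nonneg (K n s)]) (mem_Ici.2 le_rfl) (mem_Ici.2 ht)
  simpa [K_zero hn, abs_of_nonneg ht] using h

/-- The integral `∫ K_n(s) ds/s` over `[u, v]`. -/
noncomputable def logInt (n : ℕ) (u v : ℝ) : ℝ := ∫ s in u..v, K n s / s

lemma intervalIntegrable_K_div {n : ℕ} (hn : 1 ≤ n) {u v : ℝ} (hu : 0 < u) (hv : 0 < v) :
    IntervalIntegrable (fun s => K n s / s) volume u v := by
  refine ContinuousOn.intervalIntegrable fun s hs => ?_
  have : 0 < s := lt_of_lt_of_le (lt_min hu hv) hs.1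
  exact ((continuous_K hn).continuousAt.div continuousAt_id this.ne').continuousWithinAt

lemma logInt_symm (n : ℕ) (u v : ℝ) : logInt n u v = -logInt n v u :=
  intervalIntegral.integral_symm _ _

lemma logInt_add {n : ℕ} (hn : 1 ≤ n) {u v w : ℝ} (hu : 0 < u) (hv : 0 < v) (hw : 0 < w) :
    logInt n u v + logInt n v w = logInt n u w :=
  intervalIntegral.integral_add_adjacent_intervals (intervalIntegrable_K_div hn hu hv)
    (intervalIntegrable_K_div hn hv hw)

/-- Decay at infinity: one integration by parts replaces `K n s` by `K (n + 2) s = O(1 / s)`. -/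
lemma abs_logInt_le_of_le {n : ℕ} (hn : 1 ≤ n) {u v : ℝ} (hu : 0 < u) (huv : u ≤ v) :
    |logInt n u v| ≤ (n + 2) / u := by
  have hv : 0 < v := hu.trans_le huv
  have hn' : (0 : ℝ) < n := by exact_mod_cast hn
  have i2 := intervalIntegrable_K_div (by omega : 1 ≤ n + 2) hu hv
  have i1 := intervalIntegrable_K_div hn hu hv
  -- `K n s / s - K (n + 2) s / s` is the derivative of `K (n + 2) s / n`.
  have ftc : ∫ s in u..v, (K n s / s - K (n + 2) s / s) = K (n + 2) v / n - K (n + 2) u / n := by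
    refine intervalIntegral.integral_eq_sub_of_hasDerivAt (f := fun s => K (n + 2) s / n)
      (fun s hs => ?_) (i1.sub i2)
    rw [uIcc_of_le huv] at hs
    have hs0 : s ≠ 0 := (hu.trans_le hs.1).ne'
    refine ((hasDerivAt_K_add_two hn hs0).div_const (n : ℝ)).congr_deriv ?_
    field_simp
  rw [intervalIntegral.integral_sub i1 i2] at ftc
  have b2 : |∫ s in u..v, K (n + 2) s / s| ≤ n / u := by
    have hder : ∀ s ∈ uIcc u v, HasDerivAt (fun s : ℝ => -(n / s)) (n / s ^ 2) s := by
      intro s hs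
      rw [uIcc_of_le huv] at hs
      have hs0 : s ≠ 0 := (hu.trans_le hs.1).ne'
      refine ((hasDerivAt_inv hs0).const_mul (n : ℝ)).neg.congr_deriv ?_
      field_simp
    have hint : IntervalIntegrable (fun s : ℝ => n / s ^ 2) volume u v := by
      refine ContinuousOn.intervalIntegrable fun s hs => ?_
      rw [uIcc_of_le huv] at hs
      have : 0 < s := hu.trans_le hs.1
      exact (continuousAt_const.div (by fun_prop) (by positivity)).continuousWithinAt
    have h := intervalIntegral.norm_integral_le_of_norm_le (f := fun s => K (n + 2) s / s) huv
      (Eventually.of_forall fun s hs => ?_) hint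
    · rw [intervalIntegral.integral_eq_sub_of_hasDerivAt hder hint] at h
      have : 0 ≤ n / v := by positivity
      refine h.trans ?_
      linarith
    · have hs0 : 0 < s := hu.trans hs.1
      rw [Real.norm_eq_abs, abs_div, abs_of_pos hs0, pow_two, ← div_div]
      exact div_le_div_of_nonneg_right (abs_K_add_two_le hn hs0) hs0.le
  have b : ∀ s, 0 < s → |K (n + 2) s / n| ≤ 1 / s := fun s hs => by
    rw [abs_div, abs_of_pos hn', div_le_iff₀ hn']
    refine (abs_K_add_two_le hn hs).trans_eq ?_
    ring
  have e : logInt n u v = K (n + 2) v / n - K (n + 2) u / n + ∫ s in u..v, K (n + 2) s / s := by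
    rw [logInt]; linarith
  have : 1 / v ≤ 1 / u := one_div_le_one_div_of_le hu huv
  rw [e]
  have h1 := abs_add_le (K (n + 2) v / n - K (n + 2) u / n) (∫ s in u..v, K (n + 2) s / s)
  have h2 := abs_sub (K (n + 2) v / n) (K (n + 2) u / n)
  have : ((n : ℝ) + 2) / u = n / u + 1 / u + 1 / u := by ring
  linarith [b u hu, b v hv]

lemma abs_logInt_le {n : ℕ} (hn : 1 ≤ n) {u v : ℝ} (hu : 0 < u) (hv : 0 < v) :
    |logInt n u v| ≤ (n + 2) / min u v := by
  rcases le_total u v with h | h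
  · simpa [h] using abs_logInt_le_of_le hn hu h
  · rw [logInt_symm, abs_neg]
    simpa [h] using abs_logInt_le_of_le hn hv h

/-- Behaviour near `0`, where `K n` is close to `1`. -/
lemma abs_logInt_sub_log_le {n : ℕ} (hn : 1 ≤ n) {u v : ℝ} (hu : 0 < u) (hv : 0 < v) :
    |logInt n u v - Real.log (v / u)| ≤ |v - u| := by
  have hpos : ∀ s ∈ uIcc u v, 0 < s := fun s hs => lt_of_lt_of_le (lt_min hu hv) hs.1
  have h0 : (0 : ℝ) ∉ uIcc u v := fun h => (hpos 0 h).false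
  have i1 := intervalIntegrable_K_div hn hu hv
  have i2 : IntervalIntegrable (fun s : ℝ => 1 / s) volume u v :=
    intervalIntegral.intervalIntegrable_one_div (fun s hs => (hpos s hs).ne') continuousOn_id
  rw [logInt, ← integral_one_div (a := u) (b := v) h0, ← intervalIntegral.integral_sub i1 i2]
  refine (intervalIntegral.norm_integral_le_of_norm_le_const (C := 1) (a := u) (b := v)
    (f := fun s : ℝ => K n s / s - 1 / s) fun s hs => ?_).trans_eq (one_mul _)
  have hs0 : 0 < s := hpos s (uIoc_subset_uIcc hs)
  rw [← sub_div, norm_div, Real.norm_eq_abs, Real.norm_eq_abs, abs_of_pos hs0, div_le_one hs0]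
  exact abs_K_sub_one_le hn hs0.le

/-- Up to a bounded error, `∫_u^v K_n(s) ds/s` is `∫ ds/s` over `[u, v] ∩ (0, 1]`. -/
lemma abs_logInt_sub_posLog_le {n : ℕ} (hn : 1 ≤ n) {u v : ℝ} (hu : 0 < u) (hv : 0 < v) :
    |logInt n u v - (Real.posLog u⁻¹ - Real.posLog v⁻¹)| ≤ 2 * (n + 3) := by
  have key : ∀ w : ℝ, 0 < w → |logInt n w 1 - Real.posLog w⁻¹| ≤ n + 3 := by
    intro w hw
    have hn' : (0 : ℝ) ≤ n := n.cast_nonneg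
    rcases le_total w 1 with h | h
    · rw [Real.posLog_eq_log (by rw [abs_of_pos (by positivity)]; exact (one_le_inv₀ hw).2 h)]
      have := abs_logInt_sub_log_le hn hw one_pos
      rw [one_div] at this
      refine this.trans ?_
      rw [abs_of_nonneg (by linarith)]
      linarith
    · rw [(Real.posLog_eq_zero_iff _).2
        (by rw [abs_of_pos (by positivity)]; exact inv_le_one_of_one_le₀ h), sub_zero]
      have := abs_logInt_le hn hw one_pos
      rw [min_eq_right h, div_one] at this
      linarith
  have e : logInt n u v - (Real.posLog u⁻¹ - Real.posLog v⁻¹) =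
      (logInt n u 1 - Real.posLog u⁻¹) - (logInt n v 1 - Real.posLog v⁻¹) := by
    rw [← logInt_add hn hu one_pos hv, logInt_symm n 1 v]; ring
  rw [e]
  have := abs_sub (logInt n u 1 - Real.posLog u⁻¹) (logInt n v 1 - Real.posLog v⁻¹)
  linarith [key u hu, key v hv]

/-! ### Polar coordinates and the Fourier transform of the sphere -/

lemma comp_polar {n : ℕ} {F : Type*} (f : Rn n → F) (v : ({0}ᶜ : Set (Rn n))) :
    f (((homeomorphUnitSphereProd (Rn n) v).2 : ℝ) • ((homeomorphUnitSphereProd (Rn n) v).1 : Rn n))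
      = f v := by
  congr 1
  have : ‖(v : Rn n)‖ ≠ 0 := norm_ne_zero_iff.2 v.2
  simp [smul_smul, this]

section Sphere

variable {n : ℕ} {F : Type*} [NormedAddCommGroup F] [NormedSpace ℝ F]

/-- The surface measure of the unit sphere of `ℝⁿ`. -/
noncomputable abbrev sphereMeasure (n : ℕ) : Measure (Metric.sphere (0 : Rn n) 1) :=
  (volume : Measure (Rn n)).toSphere

lemma nontrivial_Rn (hn : 1 ≤ n) : Nontrivial (Rn n) :=
  Module.nontrivial_of_finrank_pos (R := ℝ) (by rw [finrank_euclideanSpace_fin]; omega)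

lemma sphereArea_pos (hn : 1 ≤ n) : 0 < sphereArea n := by
  have := nontrivial_Rn hn
  have h : NeZero (sphereMeasure n) := ⟨Measure.toSphere_ne_zero _⟩
  exact (measureReal_univ_pos : 0 < (sphereMeasure n).real univ)

lemma measurePreserving_polar (n : ℕ) :
    MeasurePreserving (homeomorphUnitSphereProd (Rn n)) ((volume : Measure (Rn n)).comap (↑))
      ((sphereMeasure n).prod (Measure.volumeIoiPow (n - 1))) := by
  have := (volume : Measure (Rn n)).measurePreserving_homeomorphUnitSphereProd
  rwa [finrank_euclideanSpace_fin] at this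

/-- Integration in polar coordinates. -/
lemma integral_polar (hn : 1 ≤ n) (f : Rn n → F) :
    ∫ v, f v = ∫ p, f ((p.2 : ℝ) • (p.1 : Rn n))
      ∂((sphereMeasure n).prod (Measure.volumeIoiPow (n - 1))) := by
  have := nontrivial_Rn hn
  rw [← (measurePreserving_polar n).integral_comp (Homeomorph.measurableEmbedding _)]
  simp_rw [comp_polar f]
  rw [integral_subtype_comap (measurableSet_singleton _).compl f, restrict_compl_singleton]

lemma integrable_polar {F : Type*} [NormedAddCommGroup F] (hn : 1 ≤ n) (f : Rn n → F) :
    Integrable f ↔ Integrable (fun p => f ((p.2 : ℝ) • (p.1 : Rn n)))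
      ((sphereMeasure n).prod (Measure.volumeIoiPow (n - 1))) := by
  have := nontrivial_Rn hn
  have h : Integrable f ↔ IntegrableOn f {0}ᶜ volume := by
    rw [IntegrableOn, restrict_compl_singleton]
  rw [← (measurePreserving_polar n).integrable_comp_emb (Homeomorph.measurableEmbedding _),
    h, integrableOn_iff_comap_subtypeVal (by measurability)]
  exact integrable_congr (Eventually.of_forall fun v => (comp_polar f v).symm)

lemma integral_volumeIoiPow (m : ℕ) (g : ℝ → F) :
    ∫ r : Ioi (0 : ℝ), g r ∂(Measure.volumeIoiPow m) = ∫ r in Ioi (0 : ℝ), r ^ m • g r := by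
  simp only [Measure.volumeIoiPow, ENNReal.ofReal]
  rw [integral_withDensity_eq_integral_smul,
    integral_subtype_comap measurableSet_Ioi fun a ↦ Real.toNNReal (a ^ m) • g a,
    setIntegral_congr_fun measurableSet_Ioi fun x hx ↦ ?_]
  · rw [NNReal.smul_def, Real.coe_toNNReal _ (pow_nonneg hx.out.le _)]
  · exact (measurable_subtype_coe.pow_const _).real_toNNReal

end Sphere

/-! ### Moments of the sphere -/

/-- `∫_0^∞ r^j exp(-r²/2) dr`. -/
noncomputable def radialMoment (j : ℕ) : ℝ :=
  ∫ r in Ioi (0 : ℝ), r ^ j * Real.exp (-r ^ 2 / 2)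

lemma radialMoment_eq (j : ℕ) :
    radialMoment j = (1 / 2 : ℝ) ^ (-((j : ℝ) + 1) / 2) * (1 / 2) * Real.Gamma (((j : ℝ) + 1) / 2) := by
  have h := integral_rpow_mul_exp_neg_mul_rpow (p := 2) (q := j) (b := 1 / 2) two_pos
    (by have : (0 : ℝ) ≤ j := j.cast_nonneg
        linarith) (by norm_num)
  rw [← h, radialMoment]
  refine setIntegral_congr_fun measurableSet_Ioi fun r hr => ?_
  simp only [Real.rpow_natCast, Real.rpow_two]
  congr 2
  ring

lemma radialMoment_pos (j : ℕ) : 0 < radialMoment j := by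
  rw [radialMoment_eq]
  have : 0 < Real.Gamma (((j : ℝ) + 1) / 2) := Real.Gamma_pos_of_pos (by positivity)
  positivity

lemma radialMoment_add_two_mul (j k : ℕ) :
    radialMoment (j + 2 * k) = radialMoment j * 2 ^ k * poch (((j : ℝ) + 1) / 2) k := by
  have h0 : Real.Gamma (((j : ℝ) + 1) / 2) ≠ 0 := (Real.Gamma_pos_of_pos (by positivity)).ne'
  rw [radialMoment_eq, radialMoment_eq, poch]
  have e1 : (((j + 2 * k : ℕ) : ℝ) + 1) / 2 = ((j : ℝ) + 1) / 2 + k := by push_cast; ring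
  have e2 : -(((j + 2 * k : ℕ) : ℝ) + 1) / 2 = -((j : ℝ) + 1) / 2 - k := by push_cast; ring
  rw [e1, e2, Real.rpow_sub (by norm_num), Real.rpow_natCast, one_div_pow]
  field_simp

/-- The moment `∫ y^j exp(-y²/2) dy` of the line. -/
noncomputable def lineMoment (j : ℕ) : ℝ := ∫ y : ℝ, y ^ j * Real.exp (-y ^ 2 / 2)

lemma lineMoment_even (k : ℕ) : lineMoment (2 * k) = 2 * radialMoment (2 * k) := by
  rw [radialMoment, ← integral_comp_abs (f := fun y => y ^ (2 * k) * Real.exp (-y ^ 2 / 2)),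
    lineMoment]
  simp [pow_mul]

lemma lineMoment_odd (k : ℕ) : lineMoment (2 * k + 1) = 0 := by
  have h := integral_neg_eq_self (fun y : ℝ => y ^ (2 * k + 1) * Real.exp (-y ^ 2 / 2)) volume
  simp only [Odd.neg_pow (odd_two_mul_add_one k), neg_sq, neg_mul, integral_neg] at h
  rw [lineMoment]
  linarith

section Moments

variable {n : ℕ}

/-- The moment `∫ ⟨θ, x⟩^j dσ(θ)` of the unit sphere. -/
noncomputable def sphereMoment (j : ℕ) (x : Rn n) : ℝ :=
  ∫ θ, (inner ℝ (θ : Rn n) x) ^ j ∂(sphereMeasure n)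

/-- Gaussian moments of `ℝⁿ` split in polar coordinates. -/
lemma integral_inner_pow_mul_gaussian (hn : 1 ≤ n) (j : ℕ) (x : Rn n) :
    ∫ v : Rn n, (inner ℝ v x) ^ j * Real.exp (-‖v‖ ^ 2 / 2) =
      sphereMoment j x * radialMoment (n - 1 + j) := by
  rw [integral_polar hn]
  have e : ∀ p : Metric.sphere (0 : Rn n) 1 × Ioi (0 : ℝ),
      (inner ℝ ((p.2 : ℝ) • (p.1 : Rn n)) x) ^ j * Real.exp (-‖(p.2 : ℝ) • (p.1 : Rn n)‖ ^ 2 / 2) =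
      (inner ℝ (p.1 : Rn n) x) ^ j * ((p.2 : ℝ) ^ j * Real.exp (-(p.2 : ℝ) ^ 2 / 2)) := by
    intro p
    have : ‖(p.1 : Rn n)‖ = 1 := by simp
    rw [real_inner_smul_left, norm_smul, this, mul_one, Real.norm_eq_abs, sq_abs, mul_pow]
    ring
  simp_rw [e]
  rw [integral_prod_mul (fun θ : Metric.sphere (0 : Rn n) 1 => (inner ℝ (θ : Rn n) x) ^ j)
    (fun r : Ioi (0 : ℝ) => (r : ℝ) ^ j * Real.exp (-(r : ℝ) ^ 2 / 2)),
    integral_volumeIoiPow (n - 1) (fun r => r ^ j * Real.exp (-r ^ 2 / 2)), sphereMoment,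
    radialMoment]
  congr 2
  ext r
  rw [smul_eq_mul, ← mul_assoc, pow_add]

/-- The image of the Gaussian weight of `ℝⁿ` under the projection to a line is a multiple of the
Gaussian weight of the line. -/
lemma exists_integral_comp_inner_mul_gaussian (e : Rn n) (he : ‖e‖ = 1) :
    ∃ c : ℝ, ∀ g : ℝ → ℝ, Measurable g →
      ∫ v : Rn n, g (inner ℝ v e) * Real.exp (-‖v‖ ^ 2 / 2) =
        c * ∫ y : ℝ, g y * Real.exp (-y ^ 2 / 2) := by
  set w : Rn n → NNReal := fun v => Real.toNNReal (Real.exp (-‖v‖ ^ 2 / 2)) with hw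
  have hwm : Measurable w := by fun_prop
  have hwv : ∀ v, (w v : ℝ) = Real.exp (-‖v‖ ^ 2 / 2) := fun v =>
    Real.coe_toNNReal _ (Real.exp_pos _).le
  have gauss : ∀ t : ℝ, ∫ v : Rn n, Complex.exp (-(1 / 2 : ℂ) * ‖v‖ ^ 2 +
      (t * Complex.I) * (inner ℝ e v : ℝ)) =
      (Real.pi / (1 / 2 : ℂ)) ^ (Module.finrank ℝ (Rn n) / 2 : ℂ) *
        Complex.exp (-(t ^ 2 / 2 : ℝ)) := by
    intro t
    rw [GaussianFourier.integral_cexp_neg_mul_sq_norm_add (by norm_num), he]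
    congr 2
    rw [mul_pow, Complex.I_sq]
    push_cast
    ring
  have hint : Integrable (fun v : Rn n => Real.exp (-‖v‖ ^ 2 / 2)) := by
    have := (GaussianFourier.integrable_cexp_neg_mul_sq_norm_add (V := Rn n) (b := 1 / 2)
      (by norm_num) 0 0).norm
    refine this.congr (Eventually.of_forall fun v => ?_)
    simp only [Complex.norm_exp]
    congr 1
    have : -(1 / 2 : ℂ) * (‖v‖ : ℂ) ^ 2 + 0 * ((inner ℝ (0 : Rn n) v : ℝ) : ℂ) =
      ((-‖v‖ ^ 2 / 2 : ℝ) : ℂ) := by push_cast; ring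
    rw [this, Complex.ofReal_re]
  set c : ℝ := ∫ v : Rn n, Real.exp (-‖v‖ ^ 2 / 2) with hc
  have hc0 : 0 ≤ c := integral_nonneg fun v => (Real.exp_pos _).le
  have hcc : (Real.pi / (1 / 2 : ℂ)) ^ (Module.finrank ℝ (Rn n) / 2 : ℂ) = (c : ℂ) := by
    have h := gauss 0
    simp only [Complex.ofReal_zero, zero_mul, add_zero, ne_eq, OfNat.ofNat_ne_zero,
      not_false_eq_true, zero_pow, zero_div, neg_zero, Complex.exp_zero, mul_one] at h
    rw [← h, hc, ← integral_complex_ofReal]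
    refine integral_congr_ae (Eventually.of_forall fun v => ?_)
    simp only [Complex.ofReal_exp]
    congr 1
    push_cast
    ring
  set P : Measure (Rn n) := volume.withDensity fun v => (w v : ℝ≥0∞) with hP
  have hfin : IsFiniteMeasure P := isFiniteMeasure_withDensity_ofReal hint.2
  have key : P.map (fun v => inner ℝ v e) = ENNReal.ofReal c • ProbabilityTheory.gaussianReal 0 1 := by
    have : IsFiniteMeasure (ENNReal.ofReal c • ProbabilityTheory.gaussianReal 0 1) :=
      (ProbabilityTheory.gaussianReal 0 1).smul_finite ENNReal.ofReal_ne_top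
    refine Measure.ext_of_charFun (funext fun t => ?_)
    rw [charFun_apply_real, charFun_apply_real, integral_map (by fun_prop) (by fun_prop),
      integral_smul_measure, ← charFun_apply_real, ProbabilityTheory.charFun_gaussianReal, hP,
      integral_withDensity_eq_integral_smul hwm, ENNReal.toReal_ofReal hc0]
    have h := gauss t
    rw [hcc] at h
    rw [Complex.real_smul]
    convert h using 1
    · refine integral_congr_ae (Eventually.of_forall fun v => ?_)
      simp only [NNReal.smul_def, hwv, Complex.real_smul, Complex.ofReal_exp]
      rw [← Complex.exp_add, real_inner_comm e v]
      congr 1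
      push_cast
      ring
    · congr 2
      push_cast
      ring
  refine ⟨c * (√(2 * Real.pi))⁻¹, fun g hg => ?_⟩
  have h1 : ∫ v : Rn n, g (inner ℝ v e) * Real.exp (-‖v‖ ^ 2 / 2) =
      ∫ y, g y ∂(P.map (fun v => inner ℝ v e)) := by
    rw [integral_map (by fun_prop) hg.aestronglyMeasurable, hP,
      integral_withDensity_eq_integral_smul hwm]
    refine integral_congr_ae (Eventually.of_forall fun v => ?_)
    simp only [NNReal.smul_def, hwv, smul_eq_mul, mul_comm]
  rw [h1, key, integral_smul_measure, ENNReal.toReal_ofReal hc0,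
    ProbabilityTheory.integral_gaussianReal_eq_integral_smul one_ne_zero, smul_eq_mul, mul_assoc,
    ← integral_const_mul (√(2 * Real.pi))⁻¹]
  refine congrArg (c * ·) (integral_congr_ae (Eventually.of_forall fun y => ?_))
  simp [ProbabilityTheory.gaussianPDFReal_def]
  ring

lemma sphereMoment_smul (j : ℕ) (a : ℝ) (x : Rn n) :
    sphereMoment j (a • x) = a ^ j * sphereMoment j x := by
  simp_rw [sphereMoment, real_inner_smul_right, mul_pow, integral_const_mul]

lemma sphereMoment_zero (x : Rn n) : sphereMoment 0 x = sphereArea n := by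
  simp [sphereMoment, sphereArea]

lemma exists_eq_norm_smul (hn : 1 ≤ n) (x : Rn n) : ∃ e : Rn n, ‖e‖ = 1 ∧ x = ‖x‖ • e := by
  have := nontrivial_Rn hn
  rcases eq_or_ne x 0 with rfl | hx
  · obtain ⟨e, he⟩ := exists_norm_eq (Rn n) zero_le_one
    exact ⟨e, he, by simp⟩
  · exact ⟨‖x‖⁻¹ • x, norm_smul_inv_norm hx, by
      rw [smul_smul, mul_inv_cancel₀ (norm_ne_zero_iff.2 hx), one_smul]⟩

lemma sphereMoment_odd (hn : 1 ≤ n) (k : ℕ) (x : Rn n) : sphereMoment (2 * k + 1) x = 0 := by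
  obtain ⟨e, he, hx⟩ := exists_eq_norm_smul hn x
  obtain ⟨c, hc⟩ := exists_integral_comp_inner_mul_gaussian e he
  have h := hc (fun y => y ^ (2 * k + 1)) (by fun_prop)
  rw [integral_inner_pow_mul_gaussian hn, ← lineMoment, lineMoment_odd, mul_zero] at h
  rw [hx, sphereMoment_smul, (mul_eq_zero.1 h).resolve_right (radialMoment_pos _).ne', mul_zero]

lemma sphereMoment_even (hn : 1 ≤ n) (k : ℕ) (x : Rn n) :
    sphereMoment (2 * k) x =
      sphereArea n * (poch (1 / 2) k / poch ((n : ℝ) / 2) k) * ‖x‖ ^ (2 * k) := by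
  obtain ⟨e, he, hx⟩ := exists_eq_norm_smul hn x
  obtain ⟨c, hc⟩ := exists_integral_comp_inner_mul_gaussian e he
  have h := hc (fun y => y ^ (2 * k)) (by fun_prop)
  -- The unknown constant `c` is eliminated by comparison with the moment of order zero.
  have h0 := hc (fun y => y ^ (2 * 0)) (by fun_prop)
  rw [integral_inner_pow_mul_gaussian hn, ← lineMoment, lineMoment_even] at h h0
  have e1 : (((n - 1 : ℕ) : ℝ) + 1) / 2 = n / 2 := by
    rw [Nat.cast_sub hn]; push_cast; ring
  rw [mul_zero, add_zero, sphereMoment_zero] at h0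
  rw [radialMoment_add_two_mul, e1] at h
  have h2 := radialMoment_add_two_mul 0 k
  rw [zero_add] at h2
  rw [h2] at h
  have hp : 0 < poch ((n : ℝ) / 2) k :=
    poch_pos (by have := half_le_half_cast hn; linarith) k
  have hr := radialMoment_pos (n - 1)
  have h3 : sphereMoment (2 * k) e = sphereArea n * (poch (1 / 2) k / poch ((n : ℝ) / 2) k) := by
    simp only [Nat.cast_zero, zero_add] at h
    have h4 : (radialMoment (n - 1) * 2 ^ k) *
        (sphereMoment (2 * k) e * poch ((n : ℝ) / 2) k) =
        (radialMoment (n - 1) * 2 ^ k) * (sphereArea n * poch (1 / 2) k) := by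
      linear_combination h - 2 ^ k * poch (1 / 2) k * h0
    have h5 := mul_left_cancel₀ (by positivity) h4
    field_simp
    exact h5
  conv_lhs => rw [hx]
  rw [sphereMoment_smul, h3]
  ring

lemma poch_half (k : ℕ) : poch (1 / 2) k * (4 ^ k * k.factorial) = (2 * k).factorial := by
  induction k with
  | zero => simp [poch_zero]
  | succ k ih =>
    have e : 2 * (k + 1) = 2 * k + 1 + 1 := by ring
    rw [poch_succ (by norm_num), e, Nat.factorial_succ, Nat.factorial_succ, Nat.factorial_succ]
    push_cast
    rw [← ih]
    ring

/-- `K n` is the Fourier transform of the uniform probability measure on the unit sphere. -/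
lemma integral_sphere_exp (hn : 1 ≤ n) (x : Rn n) :
    ∫ θ, Complex.exp (Complex.I * (inner ℝ (θ : Rn n) x : ℝ)) ∂(sphereMeasure n) =
      (sphereArea n * K n ‖x‖ : ℝ) := by
  have hle : ∀ θ : Metric.sphere (0 : Rn n) 1, |inner ℝ (θ : Rn n) x| ≤ ‖x‖ := fun θ => by
    simpa using abs_real_inner_le_norm (θ : Rn n) x
  set f : ℕ → Metric.sphere (0 : Rn n) 1 → ℂ := fun j θ =>
    (Complex.I * (inner ℝ (θ : Rn n) x : ℝ)) ^ j / (j.factorial : ℂ) with hf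
  have hfn : ∀ j θ, ‖f j θ‖ ≤ ‖x‖ ^ j / (j.factorial : ℝ) := fun j θ => by
    simp only [hf, norm_div, norm_pow, norm_mul, Complex.norm_I, one_mul, Complex.norm_real,
      Real.norm_eq_abs, Complex.norm_natCast]
    gcongr
    exact hle θ
  have hfm : ∀ j, Continuous (f j) := fun j => by
    simp only [hf]
    fun_prop
  have hfi : ∀ j, Integrable (f j) (sphereMeasure n) := fun j =>
    Integrable.of_bound (hfm j).aestronglyMeasurable _ (Eventually.of_forall (hfn j))
  have hsum : Summable fun j => ∫ θ, ‖f j θ‖ ∂(sphereMeasure n) := by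
    refine Summable.of_nonneg_of_le (fun j => integral_nonneg fun θ => norm_nonneg _) (fun j => ?_)
      ((Real.summable_pow_div_factorial ‖x‖).mul_left (sphereArea n))
    refine (integral_mono (hfi j).norm (integrable_const _) (hfn j)).trans_eq ?_
    rw [integral_const, smul_eq_mul]
    rfl
  have h1 := hasSum_integral_of_summable_integral_norm hfi hsum
  have h2 : ∀ θ, ∑' j, f j θ = Complex.exp (Complex.I * (inner ℝ (θ : Rn n) x : ℝ)) := fun θ =>
    (Complex.exp_eq_exp_ℂ ▸ NormedSpace.expSeries_div_hasSum_exp _).tsum_eq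
  simp_rw [h2] at h1
  have h3 : ∀ j, ∫ θ, f j θ ∂(sphereMeasure n) =
      Complex.I ^ j / (j.factorial : ℂ) * (sphereMoment j x : ℝ) := fun j => by
    rw [sphereMoment, ← integral_complex_ofReal, ← integral_const_mul]
    congr 1
    ext θ
    simp only [hf]
    push_cast
    ring
  have h4 := ((hasSum_kTerm hn ‖x‖).mul_left (sphereArea n)).mapL Complex.ofRealCLM
  have h5 : HasSum (fun k : ℕ => ∫ θ, f (2 * k) θ ∂(sphereMeasure n))
      ((sphereArea n * K n ‖x‖ : ℝ) : ℂ) := by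
    refine h4.congr_fun ?_
    intro k
    rw [h3, sphereMoment_even hn, pow_mul, Complex.I_sq]
    have hp : poch ((n : ℝ) / 2) k ≠ 0 :=
      (poch_pos (by have := half_le_half_cast hn; linarith) k).ne'
    have hp' : poch (1 / 2) k ≠ 0 := (poch_pos (by norm_num) k).ne'
    have e : (-1) ^ k / ((2 * k).factorial : ℝ) *
        (sphereArea n * (poch (1 / 2) k / poch ((n : ℝ) / 2) k) * ‖x‖ ^ (2 * k)) =
        sphereArea n * kTerm n k ‖x‖ := by
      rw [← poch_half, kTerm, div_pow, pow_mul 2 2 k]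
      norm_num
      field_simp
    rw [Complex.ofRealCLM_apply, ← e]
    push_cast
    ring
  have h6 : HasSum (fun j : ℕ => ∫ θ, f j θ ∂(sphereMeasure n))
      ((sphereArea n * K n ‖x‖ : ℝ) : ℂ) := by
    refine (Function.Injective.hasSum_iff (mul_right_injective₀ (two_ne_zero' ℕ)) fun j hj => ?_).1 h5
    rcases Nat.even_or_odd' j with ⟨k, rfl | rfl⟩
    · exact (hj ⟨k, rfl⟩).elim
    · rw [h3, sphereMoment_odd hn]
      simp
  exact h1.unique h6

end Moments

/-! ### The truncated kernel -/

section TruncKernel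

variable {n : ℕ}

lemma isCompact_annulus (n : ℕ) (ε N : ℝ) : IsCompact (annulus n ε N) := by
  have h : annulus n ε N = Metric.closedBall 0 N ∩ {ξ | ε ≤ ‖ξ‖} := by
    ext ξ
    simp [annulus, and_comm]
  rw [h]
  exact (isCompact_closedBall _ _).inter_right (isClosed_le continuous_const continuous_norm)

lemma measurableSet_annulus (n : ℕ) (ε N : ℝ) : MeasurableSet (annulus n ε N) :=
  (isCompact_annulus n ε N).measurableSet

lemma integrableOn_annulus {F : Type*} [NormedAddCommGroup F] {ε N : ℝ}
    (f : Rn n → F) (hf : ∀ ξ, ξ ≠ 0 → ContinuousAt f ξ) (hε : 0 < ε) :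
    IntegrableOn f (annulus n ε N) := by
  refine ContinuousOn.integrableOn_compact (isCompact_annulus n ε N) fun ξ hξ => ?_
  exact (hf ξ (norm_pos_iff.1 (hε.trans_le hξ.1))).continuousWithinAt

/-- The kernel `∫ (exp(i ξ·x) - c K_n(|ξ|)) dξ / |ξ|^n` over the annulus `ε ≤ |ξ| ≤ N`, divided by
`ω_{n-1}`, as a function of `a = |x|`. The value `c = 1` gives the kernel of the energy formula,
and `c = 0` a positive definite kernel. -/
noncomputable def truncKernel (n : ℕ) (c ε N a : ℝ) : ℝ :=
  ∫ r in ε..N, (K n (r * a) - c * K n r) / r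

/-- The integral over the annulus defining the truncated kernel, in polar coordinates. -/
lemma integral_annulus_exp (hn : 1 ≤ n) (c : ℝ) {ε N : ℝ} (hε : 0 < ε) (hN : ε ≤ N) (x : Rn n) :
    ∫ ξ in annulus n ε N,
      (Complex.exp (Complex.I * (inner ℝ ξ x : ℝ)) - (c * K n ‖ξ‖ : ℝ)) / ((‖ξ‖ ^ n : ℝ) : ℂ) =
    (sphereArea n * truncKernel n c ε N ‖x‖ : ℝ) := by
  have hK := continuous_K hn
  set f : Rn n → ℂ := fun ξ =>
    (Complex.exp (Complex.I * (inner ℝ ξ x : ℝ)) - (c * K n ‖ξ‖ : ℝ)) / ((‖ξ‖ ^ n : ℝ) : ℂ) with hf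
  have hfc : ∀ ξ, ξ ≠ 0 → ContinuousAt f ξ := fun ξ hξ => by
    refine ContinuousAt.div (by fun_prop) (by fun_prop) ?_
    exact_mod_cast pow_ne_zero _ (norm_ne_zero_iff.2 hξ)
  have hi : Integrable ((annulus n ε N).indicator f) :=
    (integrableOn_annulus f hfc hε).integrable_indicator (measurableSet_annulus n ε N)
  rw [← integral_indicator (measurableSet_annulus n ε N), integral_polar hn,
    integral_prod_symm _ ((integrable_polar hn _).1 hi)]
  have inner_eq : ∀ r : Ioi (0 : ℝ), ∫ θ, (annulus n ε N).indicator f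
      ((r : ℝ) • (θ : Rn n)) ∂(sphereMeasure n) =
      (fun r : ℝ => (Icc ε N).indicator (fun r : ℝ =>
        ((sphereArea n * ((K n (r * ‖x‖) - c * K n r) / r ^ n) : ℝ) : ℂ)) r) r := by
    rintro ⟨r, hr⟩
    have hr' : 0 < r := hr
    have hnorm : ∀ θ : Metric.sphere (0 : Rn n) 1, ‖r • (θ : Rn n)‖ = r := fun θ => by
      simp [norm_smul, abs_of_pos hr']
    by_cases hmem : r ∈ Icc ε N
    · have e : ∀ θ : Metric.sphere (0 : Rn n) 1, (annulus n ε N).indicator f (r • (θ : Rn n)) =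
          (Complex.exp (Complex.I * (inner ℝ (θ : Rn n) (r • x) : ℝ)) - (c * K n r : ℝ)) /
            ((r ^ n : ℝ) : ℂ) := fun θ => by
        rw [indicator_of_mem (by simpa [annulus, hnorm] using hmem), hf]
        simp only [hnorm, real_inner_smul_left, real_inner_smul_right]
      simp only [e, indicator_of_mem hmem]
      rw [integral_div, integral_sub, integral_sphere_exp hn, integral_const, norm_smul,
        Real.norm_of_nonneg hr'.le, Complex.real_smul]
      · rw [show (sphereMeasure n).real univ = sphereArea n from rfl]
        push_cast
        ring
      · refine Integrable.of_bound (by fun_prop) 1 (Eventually.of_forall fun θ => ?_)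
        rw [mul_comm, Complex.norm_exp_ofReal_mul_I]
      · exact integrable_const _
    · have e : ∀ θ : Metric.sphere (0 : Rn n) 1,
          (annulus n ε N).indicator f (r • (θ : Rn n)) = 0 := fun θ =>
        indicator_of_notMem (by simpa [annulus, hnorm] using hmem) _
      simp only [e, integral_zero, indicator_of_notMem hmem]
  simp_rw [inner_eq]
  rw [integral_volumeIoiPow (n - 1) (fun r : ℝ => (Icc ε N).indicator (fun r : ℝ =>
        ((sphereArea n * ((K n (r * ‖x‖) - c * K n r) / r ^ n) : ℝ) : ℂ)) r), truncKernel,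
    intervalIntegral.integral_of_le hN, ← integral_Icc_eq_integral_Ioc, ← integral_const_mul,
    ← integral_complex_ofReal]
  have e : ∀ r : ℝ, r ^ (n - 1) • (Icc ε N).indicator (fun r : ℝ =>
        ((sphereArea n * ((K n (r * ‖x‖) - c * K n r) / r ^ n) : ℝ) : ℂ)) r =
      (Icc ε N).indicator (fun r : ℝ =>
        ((sphereArea n * ((K n (r * ‖x‖) - c * K n r) / r) : ℝ) : ℂ)) r := fun r => by
    by_cases hmem : r ∈ Icc ε N
    · have hr : r ≠ 0 := (hε.trans_le hmem.1).ne'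
      rw [indicator_of_mem hmem, indicator_of_mem hmem, Complex.real_smul, ← Complex.ofReal_mul]
      congr 1
      obtain ⟨m, rfl⟩ : ∃ m, n = m + 1 := ⟨n - 1, by omega⟩
      rw [Nat.add_sub_cancel, pow_succ]
      field_simp
    · rw [indicator_of_notMem hmem, indicator_of_notMem hmem, smul_zero]
  simp_rw [e]
  rw [setIntegral_indicator measurableSet_Icc,
    inter_eq_self_of_subset_right (Icc_subset_Ioi_iff hN |>.2 hε)]

/-- Exchange of the integrals: the truncated Fourier energy of `h μ` and `k ν` is the integral of
the truncated kernel. -/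
lemma truncKernel_fubini (hn : 1 ≤ n) (c : ℝ) {ε N : ℝ} (hε : 0 < ε) (hN : ε ≤ N)
    (μ ν : Measure (Rn n)) [IsFiniteMeasure μ] [IsFiniteMeasure ν] {h k : Rn n → ℂ}
    (hh : Measurable h) (hk : Measurable k) (hh1 : ∀ x, ‖h x‖ ≤ 1) (hk1 : ∀ x, ‖k x‖ ≤ 1) :
    Integrable (fun z : Rn n × Rn n =>
      ((sphereArea n * truncKernel n c ε N ‖z.1 - z.2‖ : ℝ) : ℂ) * (h z.2 * conj (k z.1)))
      (ν.prod μ) ∧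
    ∫ ξ in annulus n ε N,
      ((∫ x, Complex.exp (Complex.I * (inner ℝ ξ x : ℝ)) * h x ∂μ) *
          conj (∫ y, Complex.exp (Complex.I * (inner ℝ ξ y : ℝ)) * k y ∂ν)
        - (c * K n ‖ξ‖ : ℝ) * ((∫ x, h x ∂μ) * conj (∫ y, k y ∂ν))) / ((‖ξ‖ ^ n : ℝ) : ℂ) =
    ∫ z, ((sphereArea n * truncKernel n c ε N ‖z.1 - z.2‖ : ℝ) : ℂ) * (h z.2 * conj (k z.1))
      ∂(ν.prod μ) := by
  have hK := (continuous_K hn).measurable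
  set G : Rn n → Rn n × Rn n → ℂ := fun ξ z =>
    (Complex.exp (Complex.I * (inner ℝ ξ (z.2 - z.1) : ℝ)) - (c * K n ‖ξ‖ : ℝ)) /
      ((‖ξ‖ ^ n : ℝ) : ℂ) * (h z.2 * conj (k z.1)) with hG
  have hhk : ∀ z : Rn n × Rn n, ‖h z.2 * conj (k z.1)‖ ≤ 1 := fun z => by
    rw [norm_mul, RCLike.norm_conj]
    exact mul_le_one₀ (hh1 _) (norm_nonneg _) (hk1 _)
  have hmul : Measurable fun z : Rn n × Rn n => h z.2 * conj (k z.1) :=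
    (hh.comp measurable_snd).mul (Complex.continuous_conj.measurable.comp (hk.comp measurable_fst))
  have hGi : Integrable (Function.uncurry G) ((volume.restrict (annulus n ε N)).prod (ν.prod μ)) := by
    have hΦ : IntegrableOn (fun ξ : Rn n => (1 + |c|) / ‖ξ‖ ^ n) (annulus n ε N) :=
      integrableOn_annulus _ (fun ξ hξ => ContinuousAt.div (by fun_prop) (by fun_prop)
        (pow_ne_zero _ (norm_ne_zero_iff.2 hξ))) hε
    refine (hΦ.mul_prod (integrable_const (1 : ℝ) (μ := ν.prod μ))).mono' ?_
      (Eventually.of_forall ?_)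
    · refine Measurable.aestronglyMeasurable ?_
      simp only [hG, Function.uncurry_def]
      refine Measurable.mul (Measurable.div ?_ (by fun_prop)) (hmul.comp measurable_snd)
      refine Measurable.sub (Continuous.measurable (by fun_prop)) ?_
      exact Complex.measurable_ofReal.comp (measurable_const.mul (hK.comp (by fun_prop)))
    · rintro ⟨ξ, z⟩
      simp only [hG, Function.uncurry_def, mul_one]
      rw [norm_mul, norm_div, Complex.norm_real, norm_pow, norm_norm]
      refine (mul_le_of_le_one_right (by positivity) (hhk z)).trans ?_
      gcongr
      refine (norm_sub_le _ _).trans (add_le_add ?_ ?_)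
      · rw [mul_comm, Complex.norm_exp_ofReal_mul_I]
      · rw [Complex.norm_real, norm_mul, Real.norm_eq_abs]
        exact mul_le_of_le_one_right (abs_nonneg _) (abs_K_le_one hn (norm_nonneg _))
  have hz : ∀ z : Rn n × Rn n, ∫ ξ in annulus n ε N, G ξ z =
      ((sphereArea n * truncKernel n c ε N ‖z.1 - z.2‖ : ℝ) : ℂ) * (h z.2 * conj (k z.1)) := by
    intro z
    simp only [hG]
    rw [integral_mul_const, integral_annulus_exp hn c hε hN, norm_sub_rev]
  have hξ : ∀ ξ : Rn n, ∫ z, G ξ z ∂(ν.prod μ) =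
      ((∫ x, Complex.exp (Complex.I * (inner ℝ ξ x : ℝ)) * h x ∂μ) *
          conj (∫ y, Complex.exp (Complex.I * (inner ℝ ξ y : ℝ)) * k y ∂ν)
        - (c * K n ‖ξ‖ : ℝ) * ((∫ x, h x ∂μ) * conj (∫ y, k y ∂ν))) / ((‖ξ‖ ^ n : ℝ) : ℂ) := by
    intro ξ
    have p1 := integral_prod_mul (μ := ν) (ν := μ)
      (fun y => conj (Complex.exp (Complex.I * (inner ℝ ξ y : ℝ)) * k y))
      (fun x => Complex.exp (Complex.I * (inner ℝ ξ x : ℝ)) * h x)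
    have p2 := integral_prod_mul (μ := ν) (ν := μ) (fun y => conj (k y)) h
    rw [integral_conj] at p1 p2
    have i1 : Integrable (fun z : Rn n × Rn n =>
        conj (Complex.exp (Complex.I * (inner ℝ ξ z.1 : ℝ)) * k z.1) *
        (Complex.exp (Complex.I * (inner ℝ ξ z.2 : ℝ)) * h z.2)) (ν.prod μ) := by
      refine Integrable.of_bound (Measurable.aestronglyMeasurable ?_) 1
        (Eventually.of_forall fun z => ?_)
      · refine Measurable.mul (Complex.continuous_conj.measurable.comp
          (Measurable.mul (Continuous.measurable (by fun_prop)) (hk.comp measurable_fst)))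
          (Measurable.mul (Continuous.measurable (by fun_prop)) (hh.comp measurable_snd))
      · rw [norm_mul, RCLike.norm_conj, norm_mul, norm_mul, mul_comm Complex.I,
          Complex.norm_exp_ofReal_mul_I, mul_comm Complex.I, Complex.norm_exp_ofReal_mul_I, one_mul,
          one_mul]
        exact mul_le_one₀ (hk1 _) (norm_nonneg _) (hh1 _)
    have i2 : Integrable (fun z : Rn n × Rn n => conj (k z.1) * h z.2) (ν.prod μ) := by
      refine Integrable.of_bound (hmul.aestronglyMeasurable.congr
        (Eventually.of_forall fun z => mul_comm _ _)) 1 (Eventually.of_forall fun z => ?_)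
      rw [mul_comm]
      exact hhk z
    have e : ∀ z : Rn n × Rn n, G ξ z =
        (conj (Complex.exp (Complex.I * (inner ℝ ξ z.1 : ℝ)) * k z.1) *
        (Complex.exp (Complex.I * (inner ℝ ξ z.2 : ℝ)) * h z.2) -
        (c * K n ‖ξ‖ : ℝ) * (conj (k z.1) * h z.2)) / ((‖ξ‖ ^ n : ℝ) : ℂ) := by
      intro z
      simp only [hG]
      have : Complex.exp (Complex.I * (inner ℝ ξ (z.2 - z.1) : ℝ)) =
          conj (Complex.exp (Complex.I * (inner ℝ ξ z.1 : ℝ))) *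
            Complex.exp (Complex.I * (inner ℝ ξ z.2 : ℝ)) := by
        rw [← Complex.exp_conj, ← Complex.exp_add, map_mul, Complex.conj_I, Complex.conj_ofReal,
          inner_sub_right]
        congr 1
        push_cast
        ring
      rw [this, map_mul]
      ring
    simp_rw [e]
    rw [integral_div, integral_sub i1 (i2.const_mul _), integral_const_mul, p1, p2]
    ring
  refine ⟨?_, ?_⟩
  · have := hGi.integral_prod_right
    simp only [Function.uncurry_def] at this
    exact this.congr (Eventually.of_forall hz)
  · simp_rw [← hξ, ← hz]
    exact integral_integral_swap hGi

/-! ### Estimates for the truncated kernel -/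

lemma truncKernel_eq (hn : 1 ≤ n) (c : ℝ) {ε N a : ℝ} (hε : 0 < ε) (hN : 0 < N) (ha : 0 < a) :
    truncKernel n c ε N a = logInt n (ε * a) (N * a) - c * logInt n ε N := by
  have h1 : ∫ r in ε..N, K n (r * a) / r = logInt n (ε * a) (N * a) := by
    have := intervalIntegral.integral_comp_mul_right (a := ε) (b := N)
      (fun s => K n s / s) ha.ne'
    rw [logInt, ← smul_right_injective ℝ (inv_ne_zero ha.ne') |>.eq_iff, ← this, smul_eq_mul,
      ← intervalIntegral.integral_const_mul]
    refine intervalIntegral.integral_congr fun r hr => ?_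
    have hr0 : r ≠ 0 := (lt_of_lt_of_le (lt_min hε hN) hr.1).ne'
    field_simp
  have i1 : IntervalIntegrable (fun r => K n (r * a) / r) volume ε N := by
    refine ContinuousOn.intervalIntegrable fun s hs => ?_
    have : 0 < s := lt_of_lt_of_le (lt_min hε hN) hs.1
    exact (((continuous_K hn).comp (continuous_id.mul continuous_const)).continuousAt.div
      continuousAt_id this.ne').continuousWithinAt
  rw [← h1, logInt, ← intervalIntegral.integral_const_mul,
    ← intervalIntegral.integral_sub i1 ((intervalIntegrable_K_div hn hε hN).const_mul c), truncKernel]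
  refine intervalIntegral.integral_congr fun r _ => ?_
  ring

lemma truncKernel_zero (hn : 1 ≤ n) (c : ℝ) {ε N : ℝ} (hε : 0 < ε) (hN : 0 < N) :
    truncKernel n c ε N 0 = Real.log (N / ε) - c * logInt n ε N := by
  have i1 : IntervalIntegrable (fun r : ℝ => 1 / r) volume ε N :=
    intervalIntegral.intervalIntegrable_one_div
      (fun s hs => (lt_of_lt_of_le (lt_min hε hN) hs.1).ne') continuousOn_id
  rw [← integral_one_div_of_pos hε hN, logInt, ← intervalIntegral.integral_const_mul,
    ← intervalIntegral.integral_sub i1 ((intervalIntegrable_K_div hn hε hN).const_mul c), truncKernel]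
  refine intervalIntegral.integral_congr fun r _ => ?_
  simp only [mul_zero, K_zero hn]
  ring

/-- Frullani's rearrangement: the integral over `[ε, N]` cancels, leaving one integral near `N` and one
near `ε`. -/
lemma truncKernel_one_eq (hn : 1 ≤ n) {ε N a : ℝ} (hε : 0 < ε) (hN : 0 < N) (ha : 0 < a) :
    truncKernel n 1 ε N a = logInt n N (N * a) - logInt n ε (ε * a) := by
  rw [truncKernel_eq hn 1 hε hN ha, one_mul, ← logInt_add hn hN (mul_pos hε ha) (mul_pos hN ha),
    ← logInt_add hn hN hε (mul_pos hε ha), logInt_symm n N ε]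
  ring

lemma posLog_inv_of_one_le {a : ℝ} (ha : 1 ≤ a) : Real.posLog a⁻¹ = 0 :=
  (Real.posLog_eq_zero_iff _).2 (by rw [abs_of_pos (by positivity)]; exact inv_le_one_of_one_le₀ ha)

lemma posLog_inv_of_le_one {a : ℝ} (ha : 0 < a) (ha1 : a ≤ 1) :
    Real.posLog a⁻¹ = -Real.log a := by
  rw [Real.posLog_eq_log (by rw [abs_of_pos (by positivity)]; exact (one_le_inv₀ ha).2 ha1),
    Real.log_inv]

lemma posLog_inv_mul_le {a b : ℝ} :
    Real.posLog (a * b)⁻¹ ≤ Real.posLog a⁻¹ + Real.posLog b⁻¹ := by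
  rw [mul_inv]
  exact Real.posLog_mul

lemma posLog_inv_mul_le_right {a N : ℝ} (hN : 1 ≤ N) :
    Real.posLog (N * a)⁻¹ ≤ Real.posLog a⁻¹ := by
  have := posLog_inv_mul_le (a := N) (b := a)
  rwa [posLog_inv_of_one_le hN, zero_add] at this

/-- The error constant of the estimates for the truncated kernel. -/
noncomputable def errConst (n : ℕ) : ℝ := 4 * (n + 3)

lemma errConst_pos (n : ℕ) : 0 < errConst n := by unfold errConst; positivity

lemma truncKernel_one_le (hn : 1 ≤ n) {ε N a : ℝ} (hε : 0 < ε) (hN : 1 ≤ N) (ha : 0 < a) :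
    truncKernel n 1 ε N a ≤ errConst n + Real.posLog a⁻¹ := by
  have hN0 : 0 < N := by linarith
  rw [truncKernel_one_eq hn hε hN0 ha, errConst]
  have h1 := (abs_le.1 (abs_logInt_sub_posLog_le hn hN0 (mul_pos hN0 ha))).2
  have h2 := (abs_le.1 (abs_logInt_sub_posLog_le hn hε (mul_pos hε ha))).1
  rw [posLog_inv_of_one_le hN] at h1
  have h3 : 0 ≤ Real.posLog (N * a)⁻¹ := Real.posLog_nonneg
  have h4 := posLog_inv_mul_le (a := ε) (b := a)
  linarith

lemma le_truncKernel_one (hn : 1 ≤ n) {ε N a : ℝ} (hε : 0 < ε) (hε1 : ε ≤ 1) (hN : 1 ≤ N)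
    (ha : 0 ≤ a) : -(errConst n + Real.posLog a) ≤ truncKernel n 1 ε N a := by
  have hN0 : 0 < N := by linarith
  rcases ha.eq_or_lt with rfl | ha
  · have h0 : 0 ≤ truncKernel n 1 ε N 0 := by
      refine intervalIntegral.integral_nonneg (hε1.trans hN) fun r hr => ?_
      have hr0 : 0 < r := hε.trans_le hr.1
      have := (abs_le.1 (abs_K_le_one hn hr0.le)).2
      rw [mul_zero, K_zero hn, one_mul]
      exact div_nonneg (by linarith) hr0.le
    have := errConst_pos n
    have : 0 ≤ Real.posLog (0 : ℝ) := Real.posLog_nonneg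
    linarith
  rw [truncKernel_one_eq hn hε hN0 ha, errConst]
  have h1 := (abs_le.1 (abs_logInt_sub_posLog_le hn hN0 (mul_pos hN0 ha))).1
  have h2 := (abs_le.1 (abs_logInt_sub_posLog_le hn hε (mul_pos hε ha))).2
  rw [posLog_inv_of_one_le hN] at h1
  -- For `a ≥ 1` the term with `N` vanishes; for `a ≤ 1` it is at most `ln (1/a)`, and logarithms add up.
  have h3 : Real.posLog ε⁻¹ + Real.posLog (N * a)⁻¹ ≤ Real.posLog (ε * a)⁻¹ + Real.posLog a := by
    rcases le_total 1 a with h | h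
    · have hNa : 1 ≤ N * a := by nlinarith
      rw [posLog_inv_of_one_le hNa, add_zero]
      have e : ε⁻¹ = (ε * a)⁻¹ * a := by field_simp
      conv_lhs => rw [e]
      exact Real.posLog_mul
    · have := posLog_inv_mul_le_right (a := a) hN
      rw [posLog_inv_of_le_one (mul_pos hε ha) (mul_le_one₀ hε1 ha.le h),
        Real.log_mul hε.ne' ha.ne', posLog_inv_of_le_one hε hε1]
      rw [posLog_inv_of_le_one ha h] at this
      have : 0 ≤ Real.posLog a := Real.posLog_nonneg
      linarith
  linarith

lemma abs_truncKernel_zero_le (hn : 1 ≤ n) {ε N a : ℝ} (hε : 0 < ε) (hN : ε ≤ N) (ha : 0 < a) :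
    |truncKernel n 0 ε N a| ≤ errConst n + Real.posLog ε⁻¹ + Real.posLog a⁻¹ := by
  have hN0 : 0 < N := by linarith
  rw [truncKernel_eq hn 0 hε hN0 ha, errConst, zero_mul, sub_zero]
  have h1 := abs_le.1 (abs_logInt_sub_posLog_le hn (mul_pos hε ha) (mul_pos hN0 ha))
  have h3 : 0 ≤ Real.posLog (N * a)⁻¹ := Real.posLog_nonneg
  have h5 : 0 ≤ Real.posLog (ε * a)⁻¹ := Real.posLog_nonneg
  have h4 := posLog_inv_mul_le (a := ε) (b := a)
  have h6 : Real.posLog (N * a)⁻¹ ≤ Real.posLog (ε * a)⁻¹ := by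
    have := posLog_inv_mul_le_right (a := ε * a) (N := N / ε) ((one_le_div hε).2 hN)
    rwa [← mul_assoc, div_mul_cancel₀ _ hε.ne'] at this
  have : (0 : ℝ) ≤ n := n.cast_nonneg
  rw [abs_le]
  constructor <;> linarith [h1.1, h1.2]

lemma le_truncKernel_zero (hn : 1 ≤ n) {N a : ℝ} (hN : 1 ≤ N) (ha : 0 < a) :
    Real.posLog a⁻¹ - Real.posLog (N * a)⁻¹ - errConst n ≤ truncKernel n 0 1 N a := by
  have hN0 : 0 < N := by linarith
  rw [truncKernel_eq hn 0 one_pos hN0 ha, errConst, zero_mul, sub_zero, one_mul]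
  have h1 := abs_le.1 (abs_logInt_sub_posLog_le hn ha (mul_pos hN0 ha))
  have : (0 : ℝ) ≤ n := n.cast_nonneg
  linarith [h1.1, h1.2]

lemma eventually_twoSided : ∀ᶠ p in twoSided, 0 < p.1 ∧ p.1 ≤ 1 ∧ 1 ≤ p.2 := by
  have h1 : ∀ᶠ ε in 𝓝[>] (0 : ℝ), 0 < ε ∧ ε ≤ 1 := by
    filter_upwards [Ioc_mem_nhdsGT (zero_lt_one' ℝ)] with ε hε using hε
  exact (h1.prod_mk (eventually_ge_atTop 1)).mono fun p hp => ⟨hp.1.1, hp.1.2, hp.2⟩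

lemma tendsto_truncKernel_one (hn : 1 ≤ n) {a : ℝ} (ha : 0 < a) :
    Tendsto (fun p : ℝ × ℝ => truncKernel n 1 p.1 p.2 a) twoSided (𝓝 (Real.log (1 / a))) := by
  have h1 : Tendsto (fun N : ℝ => logInt n N (N * a)) atTop (𝓝 0) := by
    have hb : Tendsto (fun N : ℝ => (n + 2) / (N * min 1 a)) atTop (𝓝 0) :=
      Tendsto.div_atTop tendsto_const_nhds
        (tendsto_id.atTop_mul_const (lt_min one_pos ha))
    refine squeeze_zero_norm' ?_ hb
    filter_upwards [eventually_gt_atTop 0] with N hN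
    refine (abs_logInt_le hn hN (mul_pos hN ha)).trans_eq ?_
    rw [mul_min_of_nonneg _ _ hN.le, mul_one]
  have h2 : Tendsto (fun ε : ℝ => logInt n ε (ε * a)) (𝓝[>] 0) (𝓝 (Real.log a)) := by
    rw [tendsto_iff_norm_sub_tendsto_zero]
    have hb : Tendsto (fun ε : ℝ => |ε * a - ε|) (𝓝[>] 0) (𝓝 0) := by
      have : Continuous fun ε : ℝ => |ε * a - ε| := by fun_prop
      have := this.tendsto 0
      simp only [zero_mul, sub_self, abs_zero] at this
      exact this.mono_left nhdsWithin_le_nhds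
    refine squeeze_zero' (Eventually.of_forall fun _ => norm_nonneg _) ?_ hb
    filter_upwards [self_mem_nhdsWithin] with ε hε
    have hε' : 0 < ε := hε
    have := abs_logInt_sub_log_le hn hε' (mul_pos hε' ha)
    rwa [mul_div_cancel_left₀ _ hε'.ne'] at this
  have h3 := (h1.comp (tendsto_snd (f := 𝓝[>] (0 : ℝ)))).sub (h2.comp (tendsto_fst (g := atTop)))
  rw [one_div, Real.log_inv, ← zero_sub]
  refine h3.congr' ?_
  filter_upwards [eventually_twoSided] with p hp
  exact (truncKernel_one_eq hn hp.1 (by linarith) ha).symm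

lemma tendsto_truncKernel_one_zero (hn : 1 ≤ n) :
    Tendsto (fun p : ℝ × ℝ => truncKernel n 1 p.1 p.2 0) twoSided atTop := by
  have h : Tendsto (fun p : ℝ × ℝ => Real.log p.2 - (n + 3)) twoSided atTop :=
    tendsto_atTop_add_const_right _ _ (Real.tendsto_log_atTop.comp tendsto_snd)
  refine tendsto_atTop_mono' _ ?_ h
  filter_upwards [eventually_twoSided] with p ⟨h1, h2, h3⟩
  have hN : 0 < p.2 := by linarith
  rw [truncKernel_zero hn 1 h1 hN, ← logInt_add hn h1 one_pos hN,
    Real.log_div hN.ne' h1.ne']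
  have e1 := (abs_le.1 (abs_logInt_le_of_le hn one_pos h3)).2
  have e2 := (abs_le.1 (abs_logInt_sub_log_le hn h1 one_pos)).2
  rw [one_div, Real.log_inv, abs_of_nonneg (by linarith)] at e2
  rw [div_one] at e1
  linarith

end TruncKernel

/-! ### Polar decomposition of complex measures -/

section PolarDecomposition

variable {X : Type*} [MeasurableSpace X]

lemma isFiniteMeasure_variation (μ : ComplexMeasure X) : IsFiniteMeasure μ.variation := by
  refine isFiniteMeasure_of_le
    ((ComplexMeasure.re μ).totalVariation + (ComplexMeasure.im μ).totalVariation) ?_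
  refine VectorMeasure.variation_le_of_forall_enorm_le fun s _ => ?_
  have h : μ s = ((ComplexMeasure.re μ s : ℝ) : ℂ) + (ComplexMeasure.im μ s : ℝ) * Complex.I :=
    (Complex.re_add_im (μ s)).symm
  rw [h, Measure.add_apply]
  refine (enorm_add_le _ _).trans (add_le_add ?_ ?_)
  · refine le_of_eq_of_le ?_ ((ComplexMeasure.re μ).enorm_le_totalVariation s)
    rw [← ofReal_norm, Complex.norm_real, ofReal_norm]
  · refine le_of_eq_of_le ?_ ((ComplexMeasure.im μ).enorm_le_totalVariation s)
    rw [← ofReal_norm, norm_mul, Complex.norm_I, mul_one, Complex.norm_real, ofReal_norm]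

lemma integrable_of_norm_eq_one {ρ : Measure X} [IsFiniteMeasure ρ] {h : X → ℂ}
    (hm : Measurable h) (h1 : ∀ x, ‖h x‖ = 1) : Integrable h ρ :=
  Integrable.of_bound hm.aestronglyMeasurable 1 (Eventually.of_forall fun x => (h1 x).le)

lemma variation_withDensity_of_norm_eq_one (ρ : Measure X) [IsFiniteMeasure ρ] {h : X → ℂ}
    (hm : Measurable h) (h1 : ∀ x, ‖h x‖ = 1) :
    VectorMeasure.variation (ρ.withDensityᵥ h) = ρ := by
  rw [Measure.variation_withDensityᵥ (integrable_of_norm_eq_one hm h1)]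
  simp [← ofReal_norm, h1]

/-- Polar decomposition of a complex measure: a density of modulus one with respect to the total
variation. -/
lemma exists_polar (μ : ComplexMeasure X) :
    ∃ h : X → ℂ, Measurable h ∧ (∀ x, ‖h x‖ = 1) ∧ μ = μ.variation.withDensityᵥ h := by
  have := isFiniteMeasure_variation μ
  set ρ := μ.variation with hρ
  have hac : ∀ s, MeasurableSet s → ρ s = 0 → μ s = 0 := fun s _ hs => by
    have := VectorMeasure.enorm_measure_le_variation μ s
    rwa [← hρ, hs, nonpos_iff_eq_zero, enorm_eq_zero] at this
  have hre : ρ.withDensityᵥ ((ComplexMeasure.re μ).rnDeriv ρ) = ComplexMeasure.re μ := by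
    refine SignedMeasure.withDensityᵥ_rnDeriv_eq _ _ (VectorMeasure.AbsolutelyContinuous.mk
      fun s hs h0 => ?_)
    rw [Measure.toENNRealVectorMeasure_apply_measurable hs] at h0
    exact congrArg Complex.re (hac s hs h0)
  have him : ρ.withDensityᵥ ((ComplexMeasure.im μ).rnDeriv ρ) = ComplexMeasure.im μ := by
    refine SignedMeasure.withDensityᵥ_rnDeriv_eq _ _ (VectorMeasure.AbsolutelyContinuous.mk
      fun s hs h0 => ?_)
    rw [Measure.toENNRealVectorMeasure_apply_measurable hs] at h0
    exact congrArg Complex.im (hac s hs h0)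
  have hi : Integrable (μ.rnDeriv ρ) ρ := μ.integrable_rnDeriv ρ
  have hμ : ρ.withDensityᵥ (μ.rnDeriv ρ) = μ := by
    ext s hs
    rw [withDensityᵥ_apply hi hs]
    apply Complex.ext
    · rw [← RCLike.re_eq_complex_re, ← integral_re hi.integrableOn]
      have := congrArg (fun m : SignedMeasure X => m s) hre
      simp only [withDensityᵥ_apply (SignedMeasure.integrable_rnDeriv _ _) hs] at this
      exact this
    · rw [← RCLike.im_eq_complex_im, ← integral_im hi.integrableOn]
      have := congrArg (fun m : SignedMeasure X => m s) him
      simp only [withDensityᵥ_apply (SignedMeasure.integrable_rnDeriv _ _) hs] at this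
      exact this
  -- The variation of `ρ.withDensityᵥ f` has density `‖f‖`, and here it is `ρ` itself.
  have hn : ∀ᵐ x ∂ρ, ‖μ.rnDeriv ρ x‖ₑ = 1 := by
    have h1 := Measure.variation_withDensityᵥ hi
    rw [hμ, ← hρ] at h1
    have h2 : ρ.withDensity (fun x => ‖μ.rnDeriv ρ x‖ₑ) = ρ.withDensity 1 := by
      rw [← h1, withDensity_one]
    exact (withDensity_eq_iff_of_sigmaFinite hi.aestronglyMeasurable.enorm
      aemeasurable_one).1 h2
  set g := hi.aestronglyMeasurable.mk _ with hg
  have hgm : Measurable g := hi.aestronglyMeasurable.stronglyMeasurable_mk.measurable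
  have hge : μ.rnDeriv ρ =ᵐ[ρ] g := hi.aestronglyMeasurable.ae_eq_mk
  classical
  refine ⟨fun x => if ‖g x‖ = 1 then g x else 1, ?_, fun x => ?_, ?_⟩
  · exact Measurable.ite (hgm.norm (measurableSet_singleton 1)) hgm measurable_const
  · by_cases h : ‖g x‖ = 1 <;> simp [h]
  · conv_lhs => rw [← hμ]
    refine WithDensityᵥEq.congr_ae ?_
    filter_upwards [hn, hge] with x h1 h2
    rw [h2, ← ofReal_norm, ENNReal.ofReal_eq_one] at h1
    rw [h2, if_pos h1]

/-- By density of simple functions in `L¹`. -/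
lemma cintegral_withDensity (ρ : Measure X) [IsFiniteMeasure ρ] {h : X → ℂ}
    (hm : Measurable h) (h1 : ∀ x, ‖h x‖ = 1) {f : X → ℂ} (hf : Integrable f ρ) :
    cintegral (ρ.withDensityᵥ h) f = ∫ x, f x * h x ∂ρ := by
  have hv := variation_withDensity_of_norm_eq_one ρ hm h1
  have hhi := integrable_of_norm_eq_one (ρ := ρ) hm h1
  have hmul : ∀ {g : X → ℂ}, Integrable g ρ → Integrable (fun x => g x * h x) ρ := fun {g} hg =>
    hg.mul_bdd (c := 1) hm.aestronglyMeasurable (Eventually.of_forall fun x => (h1 x).le)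
  unfold cintegral
  refine Integrable.induction (μ := ρ) (P := fun f => VectorMeasure.integral (ρ.withDensityᵥ h) f
    (ContinuousLinearMap.mul ℝ ℂ) = ∫ x, f x * h x ∂ρ) ?_ ?_ ?_ ?_ hf
  · intro c s hs hfin
    rw [VectorMeasure.integral_eq_setToFun,
      setToFun_indicator_const _ hs (by rw [hv]; exact hfin.ne)]
    have : (fun x => s.indicator (fun _ => c) x * h x) = s.indicator fun x => c * h x := by
      ext x
      by_cases hx : x ∈ s <;> simp [hx]
    rw [this, integral_indicator hs, integral_const_mul, ← withDensityᵥ_apply hhi hs]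
    rfl
  · intro f g _ hfi hgi hf hg
    rw [VectorMeasure.integral_add (hv.symm ▸ hfi : Integrable f _)
      (hv.symm ▸ hgi : Integrable g _), hf, hg,
      ← integral_add (hmul hfi) (hmul hgi)]
    simp only [Pi.add_apply, add_mul]
  · have c1 : Continuous fun f : X →₁[ρ] ℂ =>
        VectorMeasure.integral (ρ.withDensityᵥ h) f (ContinuousLinearMap.mul ℝ ℂ) := by
      have := VectorMeasure.continuous_integral (μ := ρ.withDensityᵥ h)
        (B := ContinuousLinearMap.mul ℝ ℂ)
      rw [hv] at this
      exact this
    have c2 : Continuous fun f : X →₁[ρ] ℂ => ∫ x, f x * h x ∂ρ := by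
      refine LipschitzWith.continuous (K := 1) (LipschitzWith.of_dist_le_mul fun f g => ?_)
      have hfi := L1.integrable_coeFn f
      have hgi := L1.integrable_coeFn g
      rw [dist_eq_norm, dist_eq_norm, ← integral_sub (hmul hfi) (hmul hgi), NNReal.coe_one,
        one_mul, L1.norm_eq_integral_norm]
      refine (norm_integral_le_integral_norm _).trans_eq (integral_congr_ae ?_)
      filter_upwards [Lp.coeFn_sub f g] with x hx
      rw [hx, ← sub_mul, norm_mul, h1, mul_one, Pi.sub_apply]
    exact isClosed_eq c1 c2
  · intro f g hfg _ hf
    rw [← VectorMeasure.integral_congr_ae (hv.symm ▸ hfg : f =ᵐ[_] g), hf]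
    exact integral_congr_ae (by filter_upwards [hfg] with x hx; rw [hx])

lemma conjMeasure_withDensity (ρ : Measure X) [IsFiniteMeasure ρ] {h : X → ℂ}
    (hm : Measurable h) (h1 : ∀ x, ‖h x‖ = 1) :
    conjMeasure (ρ.withDensityᵥ h) = ρ.withDensityᵥ fun x => conj (h x) := by
  have hhi := integrable_of_norm_eq_one (ρ := ρ) hm h1
  have hhi' : Integrable (fun x => conj (h x)) ρ :=
    integrable_of_norm_eq_one (Complex.continuous_conj.measurable.comp hm) fun x => by
      rw [RCLike.norm_conj, h1]
  ext s hs
  rw [withDensityᵥ_apply hhi' hs, integral_conj, ← withDensityᵥ_apply hhi hs]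
  rfl

end PolarDecomposition

/-! ### The logarithmic kernel -/

section Kernel

variable {n : ℕ}

lemma measurable_truncKernel (hn : 1 ≤ n) (c ε N : ℝ) : Measurable (truncKernel n c ε N) := by
  have hK := (continuous_K hn).measurable
  have hm : StronglyMeasurable (Function.uncurry fun (a r : ℝ) => (K n (r * a) - c * K n r) / r) := by
    refine Measurable.stronglyMeasurable (Measurable.div (Measurable.sub (hK.comp (by fun_prop)) ?_)
      (by fun_prop))
    exact measurable_const.mul (hK.comp (by fun_prop))
  unfold truncKernel
  simp only [intervalIntegral]
  exact (hm.integral_prod_right (ν := volume.restrict (Ioc ε N))).measurable.sub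
    (hm.integral_prod_right (ν := volume.restrict (Ioc N ε))).measurable

lemma kernel_self (x : Rn n) : kernel x x = ⊤ := by simp [kernel]

lemma kernel_of_ne {x y : Rn n} (h : x ≠ y) :
    kernel x y = ((Real.log (1 / ‖x - y‖) : ℝ) : EReal) := by
  have h0 : 0 < ‖x - y‖ := norm_pos_iff.2 (sub_ne_zero.2 h)
  rw [kernel, edist_dist, dist_eq_norm, ← ENNReal.ofReal_inv_of_pos h0,
    ENNReal.log_ofReal_of_pos (by positivity), one_div]

lemma measurable_kernel : Measurable fun z : Rn n × Rn n => kernel z.1 z.2 :=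
  (measurable_edist.inv).ennreal_log

lemma measurable_neg_kernel : Measurable fun z : Rn n × Rn n => -kernel z.1 z.2 :=
  measurable_kernel.neg

lemma kernel_pos_self (x : Rn n) : (kernel x x).toENNReal = ⊤ := by simp [kernel_self]

lemma kernel_pos_of_ne {x y : Rn n} (h : x ≠ y) :
    (kernel x y).toENNReal = ENNReal.ofReal (Real.posLog ‖x - y‖⁻¹) := by
  rw [kernel_of_ne h, EReal.real_coe_toENNReal, one_div, Real.posLog, ENNReal.ofReal_max]
  simp

lemma kernel_neg (x y : Rn n) :
    (-kernel x y).toENNReal = ENNReal.ofReal (Real.posLog ‖x - y‖) := by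
  rcases eq_or_ne x y with rfl | h
  · simp [kernel_self]
  · rw [kernel_of_ne h, ← EReal.coe_neg, EReal.real_coe_toENNReal, one_div, Real.log_inv, neg_neg,
      Real.posLog, ENNReal.ofReal_max]
    simp

lemma kernel_pos_le_abs (x y : Rn n) : (kernel x y).toENNReal ≤ (kernel x y).abs := by
  rcases eq_or_ne x y with rfl | h
  · simp [kernel_self]
  · rw [kernel_of_ne h, EReal.real_coe_toENNReal, EReal.abs_def]
    exact ENNReal.ofReal_le_ofReal (le_abs_self _)

lemma kernel_neg_le_abs (x y : Rn n) : (-kernel x y).toENNReal ≤ (kernel x y).abs := by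
  rcases eq_or_ne x y with rfl | h
  · simp [kernel_self]
  · rw [kernel_of_ne h, ← EReal.coe_neg, EReal.real_coe_toENNReal, EReal.abs_def]
    exact ENNReal.ofReal_le_ofReal (neg_le_abs _)

lemma ae_ne_of_pos_ne_top {m : Measure (Rn n × Rn n)}
    (h : ∫⁻ z, (kernel z.1 z.2).toENNReal ∂m ≠ ∞) : ∀ᵐ z ∂m, z.1 ≠ z.2 := by
  filter_upwards [ae_lt_top measurable_kernel.ereal_toENNReal h] with z hz hz'
  rw [hz', kernel_pos_self] at hz
  exact hz.false

lemma integrable_posLog_inv {m : Measure (Rn n × Rn n)}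
    (h : ∫⁻ z, (kernel z.1 z.2).toENNReal ∂m ≠ ∞) :
    Integrable (fun z : Rn n × Rn n => Real.posLog ‖z.1 - z.2‖⁻¹) m := by
  refine ⟨(Real.continuous_posLog.measurable.comp
    ((measurable_fst.sub measurable_snd).norm.inv)).aestronglyMeasurable, ?_⟩
  rw [hasFiniteIntegral_iff_ofReal (Eventually.of_forall fun _ => Real.posLog_nonneg)]
  refine lt_of_eq_of_lt (lintegral_congr_ae ?_) h.lt_top
  filter_upwards [ae_ne_of_pos_ne_top h] with z hz
  exact (kernel_pos_of_ne hz).symm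

lemma integrable_posLog {m : Measure (Rn n × Rn n)}
    (h : ∫⁻ z, (-kernel z.1 z.2).toENNReal ∂m ≠ ∞) :
    Integrable (fun z : Rn n × Rn n => Real.posLog ‖z.1 - z.2‖) m := by
  refine ⟨(Real.continuous_posLog.measurable.comp
    (measurable_fst.sub measurable_snd).norm).aestronglyMeasurable, ?_⟩
  rw [hasFiniteIntegral_iff_ofReal (Eventually.of_forall fun _ => Real.posLog_nonneg)]
  refine lt_of_eq_of_lt (lintegral_congr fun z => ?_) h.lt_top
  exact (kernel_neg z.1 z.2).symm

/-- The logarithmic kernel is absolutely integrable with respect to `m`. -/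
structure LogIntegrable (m : Measure (Rn n × Rn n)) : Prop where
  pos_ne_top : ∫⁻ z, (kernel z.1 z.2).toENNReal ∂m ≠ ∞
  neg_ne_top : ∫⁻ z, (-kernel z.1 z.2).toENNReal ∂m ≠ ∞

namespace LogIntegrable

variable {m : Measure (Rn n × Rn n)}

lemma ae_ne (h : LogIntegrable m) : ∀ᵐ z ∂m, z.1 ≠ z.2 :=
  ae_ne_of_pos_ne_top h.pos_ne_top

lemma integrable_log (h : LogIntegrable m) :
    Integrable (fun z : Rn n × Rn n => Real.log (1 / ‖z.1 - z.2‖)) m := by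
  refine ((integrable_posLog_inv h.pos_ne_top).sub (integrable_posLog h.neg_ne_top)).congr
    (Eventually.of_forall fun z => ?_)
  have := Real.posLog_sub_posLog_inv (x := ‖z.1 - z.2‖⁻¹)
  rw [inv_inv] at this
  simp only [one_div, Pi.sub_apply, this]

end LogIntegrable

lemma logIntegrable_of_abs {μ ν : Measure (Rn n)} [SFinite μ] [SFinite ν]
    (h : ∫⁻ x, ∫⁻ y, (kernel x y).abs ∂μ ∂ν < ∞) : LogIntegrable (ν.prod μ) := by
  constructor
  · rw [lintegral_prod _ measurable_kernel.ereal_toENNReal.aemeasurable]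
    exact ((lintegral_mono fun x => lintegral_mono fun y => kernel_pos_le_abs x y).trans_lt h).ne
  · rw [lintegral_prod _ measurable_neg_kernel.ereal_toENNReal.aemeasurable]
    exact ((lintegral_mono fun x => lintegral_mono fun y => kernel_neg_le_abs x y).trans_lt h).ne

/-! ### Finiteness of the mutual energy -/

lemma posLog_norm_sub_le (x y : Rn n) :
    Real.posLog ‖x - y‖ ≤ Real.log 2 + Real.posLog ‖x‖ + Real.posLog ‖y‖ :=
  (Real.posLog_le_posLog (norm_nonneg _) (norm_sub_le x y)).trans Real.posLog_add

/-- Finiteness of the negative part of the energy gives a logarithmic moment: integrate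
`ln⁺ |x| ≤ ln 2 + ln⁺ |y - x| + ln⁺ |y|` for one suitable `y`. -/
lemma LogIntegrable.integrable_posLog_norm {μ : Measure (Rn n)} [IsFiniteMeasure μ]
    (h : LogIntegrable (μ.prod μ)) : Integrable (fun x : Rn n => Real.posLog ‖x‖) μ := by
  rcases eq_or_ne μ 0 with rfl | hμ
  · simp
  have : NeZero μ := ⟨hμ⟩
  obtain ⟨y, hy⟩ := (integrable_posLog h.neg_ne_top).prod_right_ae.exists
  refine Integrable.mono' (((integrable_const (Real.log 2)).add hy).add (integrable_const (Real.posLog ‖y‖)))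
    (Real.continuous_posLog.comp continuous_norm).aestronglyMeasurable
    (Eventually.of_forall fun x => ?_)
  rw [Real.norm_of_nonneg Real.posLog_nonneg]
  have h1 : ‖x‖ ≤ ‖y - x‖ + ‖y‖ := by
    have := norm_sub_le y (y - x)
    rw [sub_sub_cancel] at this
    linarith
  exact (Real.posLog_le_posLog (norm_nonneg _) h1).trans Real.posLog_add

/-- The Fourier transform of the measure with density `h` with respect to `μ`. -/
noncomputable def fourierDensity (μ : Measure (Rn n)) (h : Rn n → ℂ) (ξ : Rn n) : ℂ :=
  ∫ x, Complex.exp (Complex.I * (inner ℝ ξ x : ℝ)) * h x ∂μ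

lemma continuous_fourierDensity (μ : Measure (Rn n)) [IsFiniteMeasure μ] {h : Rn n → ℂ}
    (hh : Measurable h) (hh1 : ∀ x, ‖h x‖ ≤ 1) : Continuous (fourierDensity μ h) := by
  refine continuous_of_dominated (bound := fun _ => (1 : ℝ)) (fun ξ => ?_)
    (fun ξ => Eventually.of_forall fun x => ?_) (integrable_const _)
    (Eventually.of_forall fun x => by fun_prop)
  · exact (Measurable.mul (Continuous.measurable (by fun_prop)) hh).aestronglyMeasurable
  · rw [norm_mul, mul_comm Complex.I, Complex.norm_exp_ofReal_mul_I, one_mul]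
    exact hh1 x

lemma integrableOn_norm_sq_fourierDensity (μ : Measure (Rn n)) [IsFiniteMeasure μ] {h : Rn n → ℂ}
    (hh : Measurable h) (hh1 : ∀ x, ‖h x‖ ≤ 1) {R : ℝ} (hR : 0 < R) (N : ℝ) :
    IntegrableOn (fun ξ => ‖fourierDensity μ h ξ‖ ^ 2 / ‖ξ‖ ^ n) (annulus n R N) := by
  have := continuous_fourierDensity μ hh hh1
  exact integrableOn_annulus _ (fun ξ hξ => ContinuousAt.div (by fun_prop) (by fun_prop)
    (pow_ne_zero _ (norm_ne_zero_iff.2 hξ))) hR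

/-- The tail integrals of `|μ̂|² / |ξ|^n` are bounded by the energy, uniformly in the density `h`:
they are integrals of the truncated kernel with `c = 0`, which is `O(1 + ln⁺ (1 / |x - y|))`. -/
lemma exists_bound_tail (hn : 1 ≤ n) (μ : Measure (Rn n)) [IsFiniteMeasure μ]
    (hμ : LogIntegrable (μ.prod μ)) {R : ℝ} (hR : 0 < R) :
    ∃ B : ℝ, ∀ h : Rn n → ℂ, Measurable h → (∀ x, ‖h x‖ ≤ 1) → ∀ N, R ≤ N →
      ∫ ξ in annulus n R N, ‖fourierDensity μ h ξ‖ ^ 2 / ‖ξ‖ ^ n ≤ B := by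
  refine ⟨∫ z, sphereArea n * (errConst n + Real.posLog R⁻¹ + Real.posLog ‖z.1 - z.2‖⁻¹)
    ∂(μ.prod μ), fun h hh hh1 N hN => ?_⟩
  have hω := sphereArea_pos hn
  obtain ⟨hi, he⟩ := truncKernel_fubini hn 0 hR hN μ μ hh hh hh1 hh1
  have e1 : ((∫ ξ in annulus n R N, ‖fourierDensity μ h ξ‖ ^ 2 / ‖ξ‖ ^ n : ℝ) : ℂ) =
      ∫ z, ((sphereArea n * truncKernel n 0 R N ‖z.1 - z.2‖ : ℝ) : ℂ) * (h z.2 * conj (h z.1))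
      ∂(μ.prod μ) := by
    rw [← he, ← integral_complex_ofReal]
    congr 1
    ext ξ
    simp only [zero_mul, Complex.ofReal_zero, sub_zero]
    rw [← fourierDensity, Complex.mul_conj, Complex.normSq_eq_norm_sq]
    push_cast
    rfl
  have h0 : 0 ≤ ∫ ξ in annulus n R N, ‖fourierDensity μ h ξ‖ ^ 2 / ‖ξ‖ ^ n :=
    integral_nonneg fun ξ => by positivity
  rw [← Real.norm_of_nonneg h0, ← Complex.norm_real, e1]
  refine norm_integral_le_of_norm_le
    (((integrable_const (errConst n + Real.posLog R⁻¹)).add (integrable_posLog_inv hμ.pos_ne_top)).const_mul _) ?_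
  filter_upwards [hμ.ae_ne] with z hz
  rw [norm_mul, Complex.norm_real, norm_mul, norm_mul, RCLike.norm_conj,
    Real.norm_of_nonneg hω.le, Real.norm_eq_abs]
  refine (mul_le_of_le_one_right (by positivity)
    (mul_le_one₀ (hh1 _) (norm_nonneg _) (hh1 _))).trans ?_
  gcongr
  exact abs_truncKernel_zero_le hn hR hN (norm_pos_iff.2 (sub_ne_zero.2 hz))

lemma integrableOn_tail (hn : 1 ≤ n) (μ : Measure (Rn n)) [IsFiniteMeasure μ]
    (hμ : LogIntegrable (μ.prod μ)) {h : Rn n → ℂ} (hh : Measurable h) (hh1 : ∀ x, ‖h x‖ ≤ 1)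
    {R : ℝ} (hR : 0 < R) :
    IntegrableOn (fun ξ => ‖fourierDensity μ h ξ‖ ^ 2 / ‖ξ‖ ^ n) {ξ : Rn n | R ≤ ‖ξ‖} := by
  obtain ⟨B, hB⟩ := exists_bound_tail hn μ hμ hR
  have hres : ∀ N : ℝ, (volume.restrict {ξ : Rn n | R ≤ ‖ξ‖}).restrict (Metric.closedBall 0 N) =
      volume.restrict (annulus n R N) := fun N => by
    rw [Measure.restrict_restrict Metric.isClosed_closedBall.measurableSet]
    congr 1
    ext ξ
    simp [annulus, and_comm]
  refine (aecover_closedBall (x := (0 : Rn n)) (r := fun N : ℝ => N)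
    tendsto_id).integrable_of_integral_norm_bounded B (fun N => ?_) ?_
  · rw [IntegrableOn, hres]
    exact integrableOn_norm_sq_fourierDensity μ hh hh1 hR N
  · filter_upwards [eventually_ge_atTop R] with N hN
    rw [hres]
    refine le_of_eq_of_le (integral_congr_ae (Eventually.of_forall fun ξ => ?_)) (hB h hh hh1 N hN)
    exact Real.norm_of_nonneg (by positivity)

/-- Positive definiteness of the truncated kernel with `c = 0` bounds the mutual energy by the two
self energies. -/
lemma LogIntegrable.prod (hn : 1 ≤ n) {μ ν : Measure (Rn n)} [IsFiniteMeasure μ]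
    [IsFiniteMeasure ν] (hμ : LogIntegrable (μ.prod μ)) (hν : LogIntegrable (ν.prod ν)) :
    LogIntegrable (ν.prod μ) := by
  have hω := sphereArea_pos hn
  constructor
  swap
  -- The negative part is controlled by the logarithmic moments of `μ` and `ν`.
  · have hi : Integrable (fun z : Rn n × Rn n =>
        Real.log 2 + Real.posLog ‖z.1‖ + Real.posLog ‖z.2‖) (ν.prod μ) :=
      ((integrable_const _).add (hν.integrable_posLog_norm.comp_fst μ)).add
        (hμ.integrable_posLog_norm.comp_snd ν)
    refine ((lintegral_mono fun z => ?_).trans_lt hi.lintegral_lt_top).ne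
    rw [kernel_neg]
    exact ENNReal.ofReal_le_ofReal (posLog_norm_sub_le _ _)
  obtain ⟨B₁, hB₁⟩ := exists_bound_tail hn μ hμ one_pos
  obtain ⟨B₂, hB₂⟩ := exists_bound_tail hn ν hν one_pos
  set one : Rn n → ℂ := fun _ => 1 with hone
  have hm1 : Measurable one := measurable_const
  have hn1 : ∀ x, ‖one x‖ ≤ 1 := fun x => by simp [hone]
  set T : ℕ → Rn n × Rn n → ℝ := fun j z => truncKernel n 0 1 (j + 1) ‖z.1 - z.2‖ with hT
  have hj : ∀ j : ℕ, (1 : ℝ) ≤ j + 1 := fun j => by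
    have : (0 : ℝ) ≤ j := j.cast_nonneg
    linarith
  have hTi : ∀ j, Integrable (T j) (ν.prod μ) ∧
      sphereArea n * ∫ z, T j z ∂(ν.prod μ) ≤ (B₁ + B₂) / 2 := by
    intro j
    obtain ⟨hi, he⟩ := truncKernel_fubini hn 0 one_pos (hj j) μ ν hm1 hm1 hn1 hn1
    have e0 : ∀ z : Rn n × Rn n,
        ((sphereArea n * truncKernel n 0 1 (j + 1) ‖z.1 - z.2‖ : ℝ) : ℂ) *
          (one z.2 * conj (one z.1)) = ((sphereArea n * T j z : ℝ) : ℂ) := fun z => by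
      simp [hone, hT]
    simp_rw [e0] at hi he
    have hi' : Integrable (fun z => sphereArea n * T j z) (ν.prod μ) := by
      have := hi.re
      simpa only [RCLike.re_eq_complex_re, Complex.ofReal_re] using this
    refine ⟨(integrable_const_mul_iff (IsUnit.mk0 _ hω.ne') _).1 hi', ?_⟩
    rw [← integral_const_mul]
    refine (le_abs_self _).trans ?_
    rw [← Real.norm_eq_abs, ← Complex.norm_real, ← integral_complex_ofReal, ← he]
    have i1 := integrableOn_norm_sq_fourierDensity μ hm1 hn1 one_pos (j + 1 : ℝ)
    have i2 := integrableOn_norm_sq_fourierDensity ν hm1 hn1 one_pos (j + 1 : ℝ)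
    refine (norm_integral_le_of_norm_le ((i1.add i2).div_const 2)
      (Eventually.of_forall fun ξ => ?_)).trans ?_
    · simp only [zero_mul, Complex.ofReal_zero, sub_zero]
      rw [← fourierDensity, ← fourierDensity, norm_div, Complex.norm_real, norm_pow, norm_norm,
        norm_mul, RCLike.norm_conj, Pi.add_apply, ← add_div, div_right_comm]
      gcongr
      nlinarith [sq_nonneg (‖fourierDensity μ one ξ‖ - ‖fourierDensity ν one ξ‖)]
    · rw [integral_div, integral_add' i1 i2]
      linarith [hB₁ one hm1 hn1 _ (hj j), hB₂ one hm1 hn1 _ (hj j)]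
  -- Fatou's lemma applies to the truncated kernels, made nonnegative by `errConst n`.
  have hpt : ∀ z : Rn n × Rn n, (kernel z.1 z.2).toENNReal ≤
      liminf (fun j : ℕ => ENNReal.ofReal (T j z + errConst n)) atTop := by
    intro z
    rcases eq_or_ne z.1 z.2 with h | h
    · have : Tendsto (fun j : ℕ => ENNReal.ofReal (T j z + errConst n)) atTop (𝓝 ⊤) := by
        refine ENNReal.tendsto_ofReal_atTop.comp (tendsto_atTop_add_const_right _ _ ?_)
        have e : ∀ j : ℕ, T j z = Real.log ((j : ℝ) + 1) := fun j => by
          have := hj j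
          simp only [hT, h, sub_self, norm_zero]
          rw [truncKernel_zero hn 0 one_pos (by linarith), zero_mul, sub_zero, div_one]
        simp_rw [e]
        exact Real.tendsto_log_atTop.comp
          (tendsto_atTop_add_const_right _ _ tendsto_natCast_atTop_atTop)
      rw [this.liminf_eq]
      exact le_top
    · have h0 : 0 < ‖z.1 - z.2‖ := norm_pos_iff.2 (sub_ne_zero.2 h)
      rw [kernel_pos_of_ne h]
      refine le_liminf_of_le (by isBoundedDefault) ?_
      have hlarge := (tendsto_atTop_add_const_right atTop (1 : ℝ)
        tendsto_natCast_atTop_atTop).eventually_ge_atTop ‖z.1 - z.2‖⁻¹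
      filter_upwards [hlarge] with j hj'
      refine ENNReal.ofReal_le_ofReal ?_
      have := le_truncKernel_zero hn (hj j) h0
      rw [posLog_inv_of_one_le (a := (j + 1) * ‖z.1 - z.2‖) ?_] at this
      · simp only [hT]
        linarith
      · calc (1 : ℝ) = ‖z.1 - z.2‖⁻¹ * ‖z.1 - z.2‖ := by field_simp
          _ ≤ _ := by gcongr
  have hnn : ∀ j z, 0 ≤ T j z + errConst n := by
    intro j z
    rcases eq_or_ne z.1 z.2 with h | h
    · have := hj j
      simp only [hT, h, sub_self, norm_zero]
      rw [truncKernel_zero hn 0 one_pos (by linarith), zero_mul, sub_zero, div_one]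
      exact add_nonneg (Real.log_nonneg this) (errConst_pos n).le
    · have := le_truncKernel_zero hn (hj j) (norm_pos_iff.2 (sub_ne_zero.2 h))
      have := posLog_inv_mul_le_right (a := ‖z.1 - z.2‖) (hj j)
      simp only [hT]
      linarith
  have hbd : ∀ j, ∫⁻ z, ENNReal.ofReal (T j z + errConst n) ∂(ν.prod μ) ≤
      ENNReal.ofReal ((B₁ + B₂) / 2 / sphereArea n + (ν.prod μ).real univ * errConst n) := by
    intro j
    rw [← ofReal_integral_eq_lintegral_ofReal (f := fun z => T j z + errConst n)
      ((hTi j).1.add (integrable_const _)) (Eventually.of_forall (hnn j)), integral_add (hTi j).1 (integrable_const _), integral_const,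
      smul_eq_mul]
    refine ENNReal.ofReal_le_ofReal (add_le_add ?_ le_rfl)
    rw [le_div_iff₀ hω, mul_comm]
    exact (hTi j).2
  refine ((lintegral_mono hpt).trans (lintegral_liminf_le' fun j => ?_)).trans_lt
    ((liminf_le_of_frequently_le' (Frequently.of_forall hbd)).trans_lt ENNReal.ofReal_lt_top) |>.ne
  exact ((hTi j).1.add (integrable_const _)).aestronglyMeasurable.aemeasurable.ennreal_ofReal

end Kernel

/-! ### Integrals with values in the extended reals -/

section ExtendedIntegral

variable {X : Type*} [MeasurableSpace X]

/-- Linearity for `A - B`, where `∞ - ∞ = -∞` may occur only on a null set. -/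
lemma quasiIntegrable_sub_and_eintegral_sub (m : Measure X) {A B : X → ℝ≥0∞} (hA : Measurable A)
    (hB : Measurable B) (hfin : ∫⁻ x, A x ∂m ≠ ∞ ∨ ∫⁻ x, B x ∂m ≠ ∞) :
    QuasiIntegrable m (fun x => (A x : EReal) - B x) ∧
      eintegral m (fun x => (A x : EReal) - B x) =
        ((∫⁻ x, A x ∂m : ℝ≥0∞) : EReal) - ((∫⁻ x, B x ∂m : ℝ≥0∞) : EReal) := by
  have hmeas : Measurable fun x => (A x : EReal) - B x := by
    simp_rw [sub_eq_add_neg]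
    exact hA.coe_ereal_ennreal.add hB.coe_ereal_ennreal.neg
  have hpos : ∀ x, ((A x : EReal) - B x).toENNReal = A x - B x := fun x => by
    rw [EReal.toENNReal_sub (EReal.coe_ennreal_nonneg _), EReal.toENNReal_coe, EReal.toENNReal_coe]
  -- The identity for the negative part fails where both functions are infinite.
  have hne : ∀ᵐ x ∂m, A x ≠ ∞ ∨ B x ≠ ∞ := by
    rcases hfin with h | h
    · filter_upwards [ae_lt_top hA h] with x hx using Or.inl hx.ne
    · filter_upwards [ae_lt_top hB h] with x hx using Or.inr hx.ne
  have hneg : ∀ᵐ x ∂m, (-((A x : EReal) - B x)).toENNReal = B x - A x := by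
    filter_upwards [hne] with x hx
    rw [EReal.neg_sub (Or.inl (EReal.coe_ennreal_ne_bot _))
      (by simpa using hx), add_comm, ← sub_eq_add_neg,
      EReal.toENNReal_sub (EReal.coe_ennreal_nonneg _), EReal.toENNReal_coe, EReal.toENNReal_coe]
  have hsum : ∫⁻ x, (A x - B x) ∂m + ∫⁻ x, B x ∂m = ∫⁻ x, (B x - A x) ∂m + ∫⁻ x, A x ∂m := by
    rw [← lintegral_add_right _ hB, ← lintegral_add_right _ hA]
    exact lintegral_congr fun x => by rw [tsub_add_eq_max, tsub_add_eq_max, max_comm]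
  have hP : ∫⁻ x, (A x - B x) ∂m ≤ ∫⁻ x, A x ∂m := lintegral_mono fun x => tsub_le_self
  have hQ : ∫⁻ x, (B x - A x) ∂m ≤ ∫⁻ x, B x ∂m := lintegral_mono fun x => tsub_le_self
  unfold QuasiIntegrable eintegral
  simp_rw [hpos]
  rw [lintegral_congr_ae hneg]
  refine ⟨⟨hmeas.aemeasurable, hfin.imp (fun h => (hP.trans_lt h.lt_top).ne)
    fun h => (hQ.trans_lt h.lt_top).ne⟩, ?_⟩
  generalize ∫⁻ x, (A x - B x) ∂m = P at *
  generalize ∫⁻ x, (B x - A x) ∂m = Q at *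
  generalize ∫⁻ x, A x ∂m = a at *
  generalize ∫⁻ x, B x ∂m = b at *
  rcases hfin with ha | hb
  · have hP' := (hP.trans_lt ha.lt_top).ne
    lift a to NNReal using ha
    lift P to NNReal using hP'
    rcases eq_or_ne b ∞ with rfl | hb
    · have : Q = ∞ := by
        rw [add_top] at hsum
        exact (ENNReal.add_eq_top.1 hsum.symm).resolve_right ENNReal.coe_ne_top
      simp [this]
    · have hQ' := (hQ.trans_lt hb.lt_top).ne
      lift b to NNReal using hb
      lift Q to NNReal using hQ'
      have : (P : ℝ) + b = Q + a := by exact_mod_cast hsum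
      simp only [EReal.coe_nnreal_eq_coe_real, ← EReal.coe_sub]
      rw [EReal.coe_eq_coe_iff]
      linarith
  · have hQ' := (hQ.trans_lt hb.lt_top).ne
    lift b to NNReal using hb
    lift Q to NNReal using hQ'
    rcases eq_or_ne a ∞ with rfl | ha
    · have : P = ∞ := by
        rw [add_top] at hsum
        exact (ENNReal.add_eq_top.1 hsum).resolve_right ENNReal.coe_ne_top
      simp [this]
    · have hP' := (hP.trans_lt ha.lt_top).ne
      lift a to NNReal using ha
      lift P to NNReal using hP'
      have : (P : ℝ) + b = Q + a := by exact_mod_cast hsum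
      simp only [EReal.coe_nnreal_eq_coe_real, ← EReal.coe_sub]
      rw [EReal.coe_eq_coe_iff]
      linarith

/-- A Fatou argument: integrals of functions with a common integrable minorant `-g` tend to `∞` as
soon as the pointwise lower limit is not integrable. -/
lemma tendsto_integral_atTop {ι : Type*} {l : Filter ι} [l.IsCountablyGenerated] {m : Measure X}
    {f : ι → X → ℝ} {g : X → ℝ} {A : X → ℝ≥0∞} (hfm : ∀ i, Measurable (f i))
    (hfi : ∀ᶠ i in l, Integrable (f i) m) (hgm : Measurable g) (hg : Integrable g m)
    (hfg : ∀ᶠ i in l, ∀ᵐ x ∂m, 0 ≤ f i x + g x)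
    (hA : ∀ᵐ x ∂m, A x ≤ liminf (fun i => ENNReal.ofReal (f i x + g x)) l)
    (htop : ∫⁻ x, A x ∂m = ∞) : Tendsto (fun i => ∫ x, f i x ∂m) l atTop := by
  have h1 : ∞ ≤ liminf (fun i => ∫⁻ x, ENNReal.ofReal (f i x + g x) ∂m) l := by
    rw [← htop]
    exact (lintegral_mono_ae hA).trans (lintegral_liminf_le' fun i =>
      ((hfm i).add hgm).ennreal_ofReal.aemeasurable)
  have h2 : Tendsto (fun i => ∫⁻ x, ENNReal.ofReal (f i x + g x) ∂m) l (𝓝 ∞) :=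
    tendsto_of_le_liminf_of_limsup_le h1 le_top
  refine tendsto_atTop.2 fun b => ?_
  filter_upwards [h2.eventually (lt_mem_nhds (ENNReal.ofReal_lt_top (r := b + ∫ x, g x ∂m))), hfi, hfg]
    with i hi hint hnn
  rw [← ofReal_integral_eq_lintegral_ofReal (f := fun x => f i x + g x) (hint.add hg) hnn,
    integral_add hint hg] at hi
  by_contra hlt
  exact absurd (ENNReal.ofReal_le_ofReal (by linarith)) (not_le.2 hi)

end ExtendedIntegral

instance : twoSided.IsCountablyGenerated :=
  inferInstanceAs (IsCountablyGenerated (𝓝[>] (0 : ℝ) ×ˢ (atTop : Filter ℝ)))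

instance : twoSided.NeBot :=
  inferInstanceAs (NeBot (𝓝[>] (0 : ℝ) ×ˢ (atTop : Filter ℝ)))

/-! ### Limits of the truncated energies -/

section Limits

variable {n : ℕ}

lemma measurable_truncKernel_norm_sub (hn : 1 ≤ n) (c ε N : ℝ) :
    Measurable fun z : Rn n × Rn n => truncKernel n c ε N ‖z.1 - z.2‖ :=
  (measurable_truncKernel hn c ε N).comp (measurable_fst.sub measurable_snd).norm

/-- The limit of the truncated energies when the kernel is absolutely integrable. -/
lemma LogIntegrable.tendsto_truncKernel (hn : 1 ≤ n) {m : Measure (Rn n × Rn n)}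
    [IsFiniteMeasure m] (hm : LogIntegrable m) {w : Rn n × Rn n → ℂ} (hw : Measurable w)
    (hw1 : ∀ z, ‖w z‖ ≤ 1) :
    Tendsto (fun p : ℝ × ℝ =>
        ∫ z, ((sphereArea n * truncKernel n 1 p.1 p.2 ‖z.1 - z.2‖ : ℝ) : ℂ) * w z ∂m)
      twoSided (𝓝 ((sphereArea n : ℂ) * ∫ z, (Real.log (1 / ‖z.1 - z.2‖) : ℂ) * w z ∂m)) := by
  have hω := sphereArea_pos hn
  rw [← integral_const_mul]
  refine tendsto_integral_filter_of_dominated_convergence (fun z => sphereArea n *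
    (errConst n + Real.posLog ‖z.1 - z.2‖⁻¹ + Real.posLog ‖z.1 - z.2‖)) ?_ ?_ ?_ ?_
  · refine Eventually.of_forall fun p => (Measurable.mul ?_ hw).aestronglyMeasurable
    exact Complex.measurable_ofReal.comp
      (measurable_const.mul (measurable_truncKernel_norm_sub hn _ _ _))
  · filter_upwards [eventually_twoSided] with p ⟨h1, h2, h3⟩
    filter_upwards [hm.ae_ne] with z hz
    have h0 : 0 < ‖z.1 - z.2‖ := norm_pos_iff.2 (sub_ne_zero.2 hz)
    rw [norm_mul, Complex.norm_real, norm_mul, Real.norm_of_nonneg hω.le]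
    refine (mul_le_of_le_one_right (by positivity) (hw1 z)).trans ?_
    gcongr
    have p1 : 0 ≤ Real.posLog ‖z.1 - z.2‖ := Real.posLog_nonneg
    have p2 : 0 ≤ Real.posLog ‖z.1 - z.2‖⁻¹ := Real.posLog_nonneg
    rw [Real.norm_eq_abs, abs_le]
    constructor
    · linarith [le_truncKernel_one hn h1 h2 h3 h0.le]
    · linarith [truncKernel_one_le hn h1 h3 h0]
  · exact (((integrable_const _).add (integrable_posLog_inv hm.pos_ne_top)).add
      (integrable_posLog hm.neg_ne_top)).const_mul _
  · filter_upwards [hm.ae_ne] with z hz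
    have h0 : 0 < ‖z.1 - z.2‖ := norm_pos_iff.2 (sub_ne_zero.2 hz)
    rw [← mul_assoc, ← Complex.ofReal_mul]
    refine Tendsto.mul_const _ ((Complex.continuous_ofReal.tendsto _).comp ?_)
    exact (tendsto_truncKernel_one hn h0).const_mul _

lemma LogIntegrable.integral_log_eq {m : Measure (Rn n × Rn n)} (hm : LogIntegrable m) :
    ((∫ z, Real.log (1 / ‖z.1 - z.2‖) ∂m : ℝ) : EReal) =
      ((∫⁻ z, (kernel z.1 z.2).toENNReal ∂m : ℝ≥0∞) : EReal) -
        ((∫⁻ z, (-kernel z.1 z.2).toENNReal ∂m : ℝ≥0∞) : EReal) := by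
  rw [integral_eq_lintegral_pos_part_sub_lintegral_neg_part hm.integrable_log]
  have e1 : ∫⁻ z, ENNReal.ofReal (Real.log (1 / ‖z.1 - z.2‖)) ∂m =
      ∫⁻ z, (kernel z.1 z.2).toENNReal ∂m := lintegral_congr_ae (by
    filter_upwards [hm.ae_ne] with z hz
    rw [kernel_of_ne hz, EReal.real_coe_toENNReal])
  have e2 : ∫⁻ z, ENNReal.ofReal (-Real.log (1 / ‖z.1 - z.2‖)) ∂m =
      ∫⁻ z, (-kernel z.1 z.2).toENNReal ∂m := lintegral_congr_ae (by
    filter_upwards [hm.ae_ne] with z hz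
    rw [kernel_of_ne hz, ← EReal.coe_neg, EReal.real_coe_toENNReal])
  rw [e1, e2, EReal.coe_sub, EReal.coe_ennreal_toReal hm.pos_ne_top,
    EReal.coe_ennreal_toReal hm.neg_ne_top]

/-- The limit of the truncated energies in the extended reals. -/
lemma tendsto_integral_truncKernel (hn : 1 ≤ n) {m : Measure (Rn n × Rn n)} [IsFiniteMeasure m]
    (hm : QuasiIntegrable m fun z => kernel z.1 z.2)
    (hint : ∀ ε N : ℝ, 0 < ε → ε ≤ N →
      Integrable (fun z : Rn n × Rn n => truncKernel n 1 ε N ‖z.1 - z.2‖) m) :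
    Tendsto (fun p : ℝ × ℝ =>
        ((sphereArea n * ∫ z, truncKernel n 1 p.1 p.2 ‖z.1 - z.2‖ ∂m : ℝ) : EReal)) twoSided
      (𝓝 ((sphereArea n : EReal) * (((∫⁻ z, (kernel z.1 z.2).toENNReal ∂m : ℝ≥0∞) : EReal) -
        ((∫⁻ z, (-kernel z.1 z.2).toENNReal ∂m : ℝ≥0∞) : EReal)))) := by
  have hω := sphereArea_pos hn
  have hint' : ∀ᶠ p in twoSided,
      Integrable (fun z : Rn n × Rn n => truncKernel n 1 p.1 p.2 ‖z.1 - z.2‖) m := by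
    filter_upwards [eventually_twoSided] with p hp
    exact hint _ _ hp.1 (hp.2.1.trans hp.2.2)
  by_cases hpos : ∫⁻ z, (kernel z.1 z.2).toENNReal ∂m = ∞
  · have hneg : ∫⁻ z, (-kernel z.1 z.2).toENNReal ∂m ≠ ∞ := hm.2.resolve_left fun h => h hpos
    rw [hpos]
    lift ∫⁻ z, (-kernel z.1 z.2).toENNReal ∂m to NNReal using hneg with b hb
    rw [EReal.coe_ennreal_top, EReal.coe_nnreal_eq_coe_real, EReal.top_sub_coe,
      EReal.coe_mul_top_of_pos hω, EReal.tendsto_coe_nhds_top_iff]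
    refine Tendsto.const_mul_atTop hω ?_
    refine tendsto_integral_atTop (g := fun z => errConst n + Real.posLog ‖z.1 - z.2‖)
      (fun p => measurable_truncKernel_norm_sub hn _ _ _) hint' ?_ ?_ ?_ ?_ hpos
    · exact measurable_const.add (Real.continuous_posLog.measurable.comp
        (measurable_fst.sub measurable_snd).norm)
    · exact (integrable_const _).add (integrable_posLog (by rw [← hb]; exact ENNReal.coe_ne_top))
    · filter_upwards [eventually_twoSided] with p ⟨h1, h2, h3⟩
      refine Eventually.of_forall fun z => ?_
      linarith [le_truncKernel_one hn h1 h2 h3 (norm_nonneg (z.1 - z.2))]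
    · refine Eventually.of_forall fun z => ?_
      -- The diagonal need not be a null set here: `μ` and `ν` may share atoms.
      rcases eq_or_ne z.1 z.2 with h | h
      · have : Tendsto (fun p : ℝ × ℝ => ENNReal.ofReal (truncKernel n 1 p.1 p.2 ‖z.1 - z.2‖ +
            (errConst n + Real.posLog ‖z.1 - z.2‖))) twoSided (𝓝 ∞) := by
          refine ENNReal.tendsto_ofReal_atTop.comp (tendsto_atTop_add_const_right _ _ ?_)
          simp only [h, sub_self, norm_zero]
          exact tendsto_truncKernel_one_zero hn
        rw [this.liminf_eq]
        exact le_top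
      · have h0 : 0 < ‖z.1 - z.2‖ := norm_pos_iff.2 (sub_ne_zero.2 h)
        have := ENNReal.tendsto_ofReal ((tendsto_truncKernel_one hn h0).add_const
          (errConst n + Real.posLog ‖z.1 - z.2‖))
        rw [this.liminf_eq, kernel_pos_of_ne h]
        refine ENNReal.ofReal_le_ofReal ?_
        have e := Real.posLog_sub_posLog_inv (x := ‖z.1 - z.2‖⁻¹)
        rw [inv_inv] at e
        rw [one_div]
        linarith [errConst_pos n]
  by_cases hneg : ∫⁻ z, (-kernel z.1 z.2).toENNReal ∂m = ∞
  · lift ∫⁻ z, (kernel z.1 z.2).toENNReal ∂m to NNReal using hpos with b hb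
    have hne : ∀ᵐ z ∂m, z.1 ≠ z.2 :=
      ae_ne_of_pos_ne_top (by rw [← hb]; exact ENNReal.coe_ne_top)
    have hℓ : Integrable (fun z : Rn n × Rn n => Real.posLog ‖z.1 - z.2‖⁻¹) m :=
      integrable_posLog_inv (by rw [← hb]; exact ENNReal.coe_ne_top)
    rw [hneg, EReal.coe_ennreal_top, EReal.coe_nnreal_eq_coe_real, EReal.sub_top,
      EReal.coe_mul_bot_of_pos hω, EReal.tendsto_coe_nhds_bot_iff]
    refine Tendsto.const_mul_atBot hω ?_
    rw [← tendsto_neg_atTop_iff]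
    simp_rw [← integral_neg]
    refine tendsto_integral_atTop (g := fun z => errConst n + Real.posLog ‖z.1 - z.2‖⁻¹)
      (fun p => (measurable_truncKernel_norm_sub hn _ _ _).neg) (hint'.mono fun p hp => hp.neg)
      ?_ ((integrable_const _).add hℓ) ?_ ?_ hneg
    · exact measurable_const.add (Real.continuous_posLog.measurable.comp
        (measurable_fst.sub measurable_snd).norm.inv)
    · filter_upwards [eventually_twoSided] with p ⟨h1, h2, h3⟩
      filter_upwards [hne] with z hz
      linarith [truncKernel_one_le hn h1 h3 (norm_pos_iff.2 (sub_ne_zero.2 hz))]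
    · filter_upwards [hne] with z h
      have h0 : 0 < ‖z.1 - z.2‖ := norm_pos_iff.2 (sub_ne_zero.2 h)
      have := ENNReal.tendsto_ofReal ((tendsto_truncKernel_one hn h0).neg.add_const
        (errConst n + Real.posLog ‖z.1 - z.2‖⁻¹))
      rw [this.liminf_eq, kernel_neg]
      refine ENNReal.ofReal_le_ofReal ?_
      have e := Real.posLog_sub_posLog_inv (x := ‖z.1 - z.2‖⁻¹)
      rw [inv_inv] at e
      rw [one_div]
      linarith [errConst_pos n]
  · have hL : LogIntegrable m := ⟨hpos, hneg⟩
    rw [← hL.integral_log_eq, ← EReal.coe_mul]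
    refine (continuous_coe_real_ereal.tendsto _).comp ?_
    have := hL.tendsto_truncKernel hn (w := fun _ => 1) measurable_const (fun _ => by simp)
    have h2 := (Complex.continuous_re.tendsto _).comp this
    simp only [mul_one, integral_complex_ofReal, ← Complex.ofReal_mul, Complex.ofReal_re,
      Function.comp_def, integral_const_mul] at h2
    exact h2

end Limits

/-! ### Complex measures -/

section ComplexMeasures

variable {n : ℕ}

/-- All quantities attached to a complex measure, expressed through a density of modulus one with
respect to its total variation. -/
lemma exists_polar_integral (μ : ComplexMeasure (Rn n)) :
    ∃ h : Rn n → ℂ, Measurable h ∧ (∀ x, ‖h x‖ = 1) ∧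
      (∀ f, Integrable f μ.variation → cintegral μ f = ∫ x, f x * h x ∂μ.variation) ∧
      (∀ f, Integrable f μ.variation →
        cintegral (conjMeasure μ) f = ∫ x, f x * conj (h x) ∂μ.variation) ∧
      μ univ = ∫ x, h x ∂μ.variation := by
  have := isFiniteMeasure_variation μ
  obtain ⟨h, hm, h1, hμ⟩ := exists_polar μ
  refine ⟨h, hm, h1, fun f hf => ?_, fun f hf => ?_, ?_⟩
  · conv_lhs => rw [hμ]
    exact cintegral_withDensity _ hm h1 hf
  · conv_lhs => rw [hμ]
    rw [conjMeasure_withDensity _ hm h1]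
    exact cintegral_withDensity _ (Complex.continuous_conj.measurable.comp hm)
      (fun x => by rw [Function.comp_apply, RCLike.norm_conj, h1]) hf
  · conv_lhs => rw [hμ]
    rw [withDensityᵥ_apply (integrable_of_norm_eq_one hm h1) MeasurableSet.univ,
      Measure.restrict_univ]

lemma conjMeasure_univ (μ : ComplexMeasure (Rn n)) : conjMeasure μ univ = conj (μ univ) := rfl

lemma fourier_eq_fourierDensity {μ : ComplexMeasure (Rn n)} {h : Rn n → ℂ}
    (hμ : ∀ f, Integrable f μ.variation → cintegral μ f = ∫ x, f x * h x ∂μ.variation)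
    (ξ : Rn n) : fourier μ ξ = fourierDensity μ.variation h ξ := by
  have := isFiniteMeasure_variation μ
  refine hμ _ (Integrable.of_bound (Continuous.aestronglyMeasurable (by fun_prop)) 1
    (Eventually.of_forall fun x => ?_))
  rw [mul_comm, Complex.norm_exp_ofReal_mul_I]

/-- The formula for the mutual energy of two complex measures whose logarithmic kernel is absolutely
integrable. -/
lemma tendsto_mutual_energy (hn : 1 ≤ n) (μ ν : ComplexMeasure (Rn n))
    (hL : LogIntegrable (ν.variation.prod μ.variation)) :
    PotentialIntegrable μ ν ∧
      Tendsto (fun p : ℝ × ℝ =>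
          ∫ ξ in annulus n p.1 p.2,
            (fourier μ ξ * conj (fourier ν ξ) - μ univ * conjMeasure ν univ * (K n ‖ξ‖ : ℂ))
              / ((‖ξ‖ ^ n : ℝ) : ℂ))
        twoSided
        (𝓝 ((sphereArea n : ℂ) * cintegral (conjMeasure ν) (cpotential μ))) := by
  have := isFiniteMeasure_variation μ
  have := isFiniteMeasure_variation ν
  obtain ⟨h, hm, h1, hμ, -, hμ1⟩ := exists_polar_integral μ
  obtain ⟨k, km, k1, hν, hνc, hν1⟩ := exists_polar_integral ν
  set μ' := μ.variation with hμ'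
  set ν' := ν.variation with hν'
  have hlog : Integrable (fun z : Rn n × Rn n => (Real.log (1 / ‖z.1 - z.2‖) : ℂ))
      (ν'.prod μ') := hL.integrable_log.ofReal
  have hlogh : Integrable (fun z : Rn n × Rn n => (Real.log (1 / ‖z.1 - z.2‖) : ℂ) * h z.2)
      (ν'.prod μ') :=
    hlog.mul_bdd (c := 1) (hm.comp measurable_snd).aestronglyMeasurable
      (Eventually.of_forall fun z => (h1 _).le)
  have hpot : ∀ᵐ x ∂ν', cpotential μ x = ∫ y, (Real.log (1 / ‖x - y‖) : ℂ) * h y ∂μ' := by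
    filter_upwards [hlog.prod_right_ae] with x hx using hμ _ hx
  have hpi : Integrable (cpotential μ) ν' :=
    hlogh.integral_prod_left.congr (hpot.mono fun x hx => hx.symm)
  refine ⟨⟨hlog.prod_right_ae, hpi⟩, ?_⟩
  have hw : Measurable fun z : Rn n × Rn n => h z.2 * conj (k z.1) :=
    (hm.comp measurable_snd).mul (Complex.continuous_conj.measurable.comp (km.comp measurable_fst))
  have hlim := hL.tendsto_truncKernel hn hw fun z => by
    rw [norm_mul, RCLike.norm_conj, h1, k1, one_mul]
  have e : ∫ z, (Real.log (1 / ‖z.1 - z.2‖) : ℂ) * (h z.2 * conj (k z.1)) ∂(ν'.prod μ') =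
      cintegral (conjMeasure ν) (cpotential μ) := by
    have hi : Integrable (fun z : Rn n × Rn n =>
        (Real.log (1 / ‖z.1 - z.2‖) : ℂ) * (h z.2 * conj (k z.1))) (ν'.prod μ') :=
      hlog.mul_bdd (c := 1) hw.aestronglyMeasurable (Eventually.of_forall fun z => by
        rw [norm_mul, RCLike.norm_conj, h1, k1, one_mul])
    rw [hνc _ hpi, integral_prod _ hi]
    refine integral_congr_ae ?_
    filter_upwards [hpot] with x hx
    rw [hx, ← integral_mul_const]
    simp only [mul_assoc]
  rw [e] at hlim
  refine hlim.congr' ?_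
  filter_upwards [eventually_twoSided] with p ⟨p1, p2, p3⟩
  rw [← (truncKernel_fubini hn 1 p1 (p2.trans p3) μ' ν' hm km (fun x => (h1 x).le)
    fun x => (k1 x).le).2]
  congr 1
  ext ξ
  rw [fourier_eq_fourierDensity hμ, fourier_eq_fourierDensity hν, conjMeasure_univ, hμ1, hν1,
    one_mul, mul_comm (K n ‖ξ‖ : ℂ)]
  rfl

end ComplexMeasures

/-! ### Nonnegative measures -/

section NonnegMeasures

variable {n : ℕ}

lemma charFun_eq_fourierDensity (μ : Measure (Rn n)) (ξ : Rn n) :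
    charFun μ ξ = fourierDensity μ (fun _ => 1) ξ := by
  rw [charFun_apply, fourierDensity]
  simp only [mul_one, mul_comm Complex.I, real_inner_comm]

/-- Tonelli's theorem for the positive and the negative part of the kernel. -/
lemma quasiIntegrable_potential {μ ν : Measure (Rn n)} [IsFiniteMeasure μ] [IsFiniteMeasure ν]
    (h : MutualEnergyExists μ ν) :
    (∀ᵐ x ∂ν, QuasiIntegrable μ (kernel x)) ∧ QuasiIntegrable ν (potential μ) ∧
      eintegral ν (potential μ) =
        ((∫⁻ z, (kernel z.1 z.2).toENNReal ∂(ν.prod μ) : ℝ≥0∞) : EReal) -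
          ((∫⁻ z, (-kernel z.1 z.2).toENNReal ∂(ν.prod μ) : ℝ≥0∞) : EReal) := by
  have hA : Measurable fun z : Rn n × Rn n => (kernel z.1 z.2).toENNReal :=
    measurable_kernel.ereal_toENNReal
  have hB : Measurable fun z : Rn n × Rn n => (-kernel z.1 z.2).toENNReal :=
    measurable_neg_kernel.ereal_toENNReal
  have hA' : ∫⁻ z, (kernel z.1 z.2).toENNReal ∂(ν.prod μ) =
      ∫⁻ x, ∫⁻ y, (kernel x y).toENNReal ∂μ ∂ν := lintegral_prod _ hA.aemeasurable
  have hB' : ∫⁻ z, (-kernel z.1 z.2).toENNReal ∂(ν.prod μ) =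
      ∫⁻ x, ∫⁻ y, (-kernel x y).toENNReal ∂μ ∂ν := lintegral_prod _ hB.aemeasurable
  have hfin := h.2
  rw [hA', hB'] at hfin
  rw [hA', hB']
  have hAm : Measurable fun x => ∫⁻ y, (kernel x y).toENNReal ∂μ := hA.lintegral_prod_right'
  have hBm : Measurable fun x => ∫⁻ y, (-kernel x y).toENNReal ∂μ := hB.lintegral_prod_right'
  have hp : potential μ = fun x => ((∫⁻ y, (kernel x y).toENNReal ∂μ : ℝ≥0∞) : EReal) -
      ((∫⁻ y, (-kernel x y).toENNReal ∂μ : ℝ≥0∞) : EReal) := rfl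
  rw [hp]
  refine ⟨?_, quasiIntegrable_sub_and_eintegral_sub ν hAm hBm hfin⟩
  have hk : ∀ x : Rn n, AEMeasurable (kernel x) μ := fun x =>
    (measurable_kernel.comp measurable_prodMk_left).aemeasurable
  rcases hfin with hfin | hfin
  · filter_upwards [ae_lt_top hAm hfin] with x hx using ⟨hk x, Or.inl hx.ne⟩
  · filter_upwards [ae_lt_top hBm hfin] with x hx using ⟨hk x, Or.inr hx.ne⟩

/-- The truncated Fourier energy of nonnegative measures as an integral of the truncated kernel. -/
lemma charFun_fubini (hn : 1 ≤ n) (μ ν : Measure (Rn n)) [IsFiniteMeasure μ] [IsFiniteMeasure ν]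
    {ε N : ℝ} (hε : 0 < ε) (hN : ε ≤ N) :
    Integrable (fun z : Rn n × Rn n => truncKernel n 1 ε N ‖z.1 - z.2‖) (ν.prod μ) ∧
    ∫ ξ in annulus n ε N,
      (charFun μ ξ * conj (charFun ν ξ) - (μ.real univ * ν.real univ * K n ‖ξ‖ : ℝ))
        / ((‖ξ‖ ^ n : ℝ) : ℂ) =
      ((sphereArea n * ∫ z, truncKernel n 1 ε N ‖z.1 - z.2‖ ∂(ν.prod μ) : ℝ) : ℂ) := by
  obtain ⟨hi, he⟩ := truncKernel_fubini hn 1 hε hN μ ν (h := fun _ => 1) (k := fun _ => 1)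
    measurable_const measurable_const (fun _ => by simp) (fun _ => by simp)
  simp only [map_one, mul_one] at hi
  constructor
  · have := hi.re
    simp only [RCLike.re_eq_complex_re, Complex.ofReal_re] at this
    exact (integrable_const_mul_iff (IsUnit.mk0 _ (sphereArea_pos hn).ne') _).1 this
  · simp only [map_one, mul_one, one_mul, integral_complex_ofReal, integral_const_mul] at he
    rw [← he]
    congr 1
    ext ξ
    rw [charFun_eq_fourierDensity, charFun_eq_fourierDensity, fourierDensity, fourierDensity]
    simp only [mul_one, integral_const, Complex.real_smul, Complex.conj_ofReal]
    push_cast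
    ring

lemma tendsto_charFun_energy (hn : 1 ≤ n) (μ ν : Measure (Rn n)) [IsFiniteMeasure μ]
    [IsFiniteMeasure ν] (h : MutualEnergyExists μ ν) :
    Tendsto (fun p : ℝ × ℝ =>
        (((∫ ξ in annulus n p.1 p.2,
          (charFun μ ξ * conj (charFun ν ξ) - (μ.real univ * ν.real univ * K n ‖ξ‖ : ℝ))
            / ((‖ξ‖ ^ n : ℝ) : ℂ)).re : ℝ) : EReal))
      twoSided (𝓝 ((sphereArea n : EReal) * eintegral ν (potential μ))) := by
  rw [(quasiIntegrable_potential h).2.2]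
  refine (tendsto_integral_truncKernel hn h
    fun ε N hε hN => (charFun_fubini hn μ ν hε hN).1).congr' ?_
  filter_upwards [eventually_twoSided] with p ⟨p1, p2, p3⟩
  rw [(charFun_fubini hn μ ν p1 (p2.trans p3)).2, Complex.ofReal_re]

lemma LogIntegrable.of_energy_ne {μ : Measure (Rn n)} [IsFiniteMeasure μ]
    (h : MutualEnergyExists μ μ) (ht : energy μ ≠ ⊤) (hb : energy μ ≠ ⊥) :
    LogIntegrable (μ.prod μ) := by
  have e := (quasiIntegrable_potential h).2.2
  rw [energy, e] at ht hb
  by_cases hp : ∫⁻ z, (kernel z.1 z.2).toENNReal ∂(μ.prod μ) = ∞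
  · have hm := h.2.resolve_left fun h' => h' hp
    rw [hp] at ht
    lift ∫⁻ z, (-kernel z.1 z.2).toENNReal ∂(μ.prod μ) to NNReal using hm with b
    rw [EReal.coe_ennreal_top, EReal.coe_nnreal_eq_coe_real, EReal.top_sub_coe] at ht
    exact (ht rfl).elim
  · refine ⟨hp, fun hm => hb ?_⟩
    rw [hm, EReal.coe_ennreal_top, EReal.sub_top]

end NonnegMeasures

end LogEnergy

theorem theorem1 (n : ℕ) (hn : 1 ≤ n) :
    -- complex measures in `M₀`
    (∀ μ ν : ComplexMeasure (LogEnergy.Rn n), LogEnergy.MemM0 μ → LogEnergy.MemM0 ν →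
      LogEnergy.PotentialIntegrable μ ν ∧
      Tendsto (fun p : ℝ × ℝ =>
          ∫ ξ in LogEnergy.annulus n p.1 p.2,
            (LogEnergy.fourier μ ξ * conj (LogEnergy.fourier ν ξ)
              - μ univ * LogEnergy.conjMeasure ν univ * (LogEnergy.K n ‖ξ‖ : ℂ))
              / ((‖ξ‖ ^ n : ℝ) : ℂ))
        LogEnergy.twoSided
        (𝓝 ((LogEnergy.sphereArea n : ℂ) *
          LogEnergy.cintegral (LogEnergy.conjMeasure ν) (LogEnergy.cpotential μ)))) ∧
    -- nonnegative measures whose mutual energy exists in `[-∞, ∞]`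
    (∀ (μ ν : Measure (LogEnergy.Rn n)) [IsFiniteMeasure μ] [IsFiniteMeasure ν],
      LogEnergy.MutualEnergyExists μ ν →
      (∀ᵐ x ∂ν, LogEnergy.QuasiIntegrable μ (LogEnergy.kernel x)) ∧
      LogEnergy.QuasiIntegrable ν (LogEnergy.potential μ) ∧
      (∀ ε N : ℝ, 0 < ε →
        (∫ ξ in LogEnergy.annulus n ε N,
            (charFun μ ξ * conj (charFun ν ξ)
              - (μ.real univ * ν.real univ * LogEnergy.K n ‖ξ‖ : ℝ)) / ((‖ξ‖ ^ n : ℝ) : ℂ)).im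
          = 0) ∧
      Tendsto (fun p : ℝ × ℝ =>
          (((∫ ξ in LogEnergy.annulus n p.1 p.2,
            (charFun μ ξ * conj (charFun ν ξ)
              - (μ.real univ * ν.real univ * LogEnergy.K n ‖ξ‖ : ℝ))
              / ((‖ξ‖ ^ n : ℝ) : ℂ)).re : ℝ) : EReal))
        LogEnergy.twoSided
        (𝓝 ((LogEnergy.sphereArea n : EReal) *
          LogEnergy.eintegral ν (LogEnergy.potential μ)))) ∧
    -- the energy of a complex measure in `M₀` (always finite)
    (∀ μ : ComplexMeasure (LogEnergy.Rn n), LogEnergy.MemM0 μ →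
      Tendsto (fun p : ℝ × ℝ =>
          ((∫ ξ in LogEnergy.annulus n p.1 p.2,
            (‖LogEnergy.fourier μ ξ‖ ^ 2 - ‖μ univ‖ ^ 2 * LogEnergy.K n ‖ξ‖) / ‖ξ‖ ^ n : ℝ) : ℂ))
        LogEnergy.twoSided
        (𝓝 ((LogEnergy.sphereArea n : ℂ) * LogEnergy.cenergy μ)) ∧
      ∀ R : ℝ, 0 < R →
        IntegrableOn (fun ξ => ‖LogEnergy.fourier μ ξ‖ ^ 2 / ‖ξ‖ ^ n)
          {ξ : LogEnergy.Rn n | R ≤ ‖ξ‖}) ∧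
    -- the energy of a nonnegative measure, where it exists in `[-∞, ∞]`
    (∀ (μ : Measure (LogEnergy.Rn n)) [IsFiniteMeasure μ],
      LogEnergy.MutualEnergyExists μ μ →
      Tendsto (fun p : ℝ × ℝ =>
          ((∫ ξ in LogEnergy.annulus n p.1 p.2,
            (‖charFun μ ξ‖ ^ 2 - μ.real univ ^ 2 * LogEnergy.K n ‖ξ‖) / ‖ξ‖ ^ n : ℝ) : EReal))
        LogEnergy.twoSided
        (𝓝 ((LogEnergy.sphereArea n : EReal) * LogEnergy.energy μ)) ∧
      (LogEnergy.energy μ ≠ ⊤ → LogEnergy.energy μ ≠ ⊥ →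
        ∀ R : ℝ, 0 < R →
          IntegrableOn (fun ξ => ‖charFun μ ξ‖ ^ 2 / ‖ξ‖ ^ n)
            {ξ : LogEnergy.Rn n | R ≤ ‖ξ‖})) := by

  have hμL : ∀ μ : ComplexMeasure (LogEnergy.Rn n), LogEnergy.MemM0 μ →
      LogEnergy.LogIntegrable (μ.variation.prod μ.variation) := fun μ hμ => by
    have := LogEnergy.isFiniteMeasure_variation μ
    exact LogEnergy.logIntegrable_of_abs hμ
  refine ⟨fun μ ν hμ hν => ?_, fun μ ν _ _ h => ⟨(LogEnergy.quasiIntegrable_potential h).1,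
    (LogEnergy.quasiIntegrable_potential h).2.1, fun ε N hε => ?_,
    LogEnergy.tendsto_charFun_energy hn μ ν h⟩, fun μ hμ => ⟨?_, fun R hR => ?_⟩,
    fun μ _ h => ⟨?_, fun ht hb R hR => ?_⟩⟩
  · have := LogEnergy.isFiniteMeasure_variation μ
    have := LogEnergy.isFiniteMeasure_variation ν
    exact LogEnergy.tendsto_mutual_energy hn μ ν ((hμL μ hμ).prod hn (hμL ν hν))
  -- For `N < ε` the annulus is empty.
  · rcases le_or_gt ε N with hN | hN
    · rw [(LogEnergy.charFun_fubini hn μ ν hε hN).2, Complex.ofReal_im]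
    · have : LogEnergy.annulus n ε N = ∅ :=
        eq_empty_of_forall_notMem fun ξ hξ => hN.not_ge (hξ.1.trans hξ.2)
      rw [this, setIntegral_empty, Complex.zero_im]
  · refine ((LogEnergy.tendsto_mutual_energy hn μ μ (hμL μ hμ)).2).congr fun p => ?_
    rw [← integral_complex_ofReal]
    congr 1
    ext ξ
    rw [LogEnergy.conjMeasure_univ, Complex.mul_conj, Complex.mul_conj, Complex.normSq_eq_norm_sq,
      Complex.normSq_eq_norm_sq]
    push_cast
    rfl
  · have := LogEnergy.isFiniteMeasure_variation μ
    obtain ⟨h, hm, h1, hi, -, -⟩ := LogEnergy.exists_polar_integral μ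
    simp_rw [LogEnergy.fourier_eq_fourierDensity hi]
    exact LogEnergy.integrableOn_tail hn _ (hμL μ hμ) hm (fun x => (h1 x).le) hR
  · refine (LogEnergy.tendsto_charFun_energy hn μ μ h).congr fun p => ?_
    rw [← Complex.ofReal_re (∫ ξ in LogEnergy.annulus n p.1 p.2,
      (‖charFun μ ξ‖ ^ 2 - μ.real univ ^ 2 * LogEnergy.K n ‖ξ‖) / ‖ξ‖ ^ n),
      ← integral_complex_ofReal]
    congr 3
    ext ξ
    rw [Complex.mul_conj, Complex.normSq_eq_norm_sq]
    push_cast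
    ring
  · simp_rw [LogEnergy.charFun_eq_fourierDensity]
    exact LogEnergy.integrableOn_tail hn μ (LogEnergy.LogIntegrable.of_energy_ne h ht hb)
      measurable_const (fun _ => by simp) hR
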